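/- Let $\mathtt{SMkM}$ be the following problem. Given are $k\ge 2$ matroids $M_1,\dots,M_k$ on a common finite ground set $\mathcal N$ and a non-negative submodular function $f\colon 2^{\mathcal N}\to\mathbb R_{\ge 0}$ (not necessarily monotone). The elements of $\mathcal N$ arrive one by one in a stream, in arbitrary order; the algorithm makes a single pass over the stream and has to output a set $S\subseteq\mathcal N$ that is independent in all $k$ matroids (a common independent set) and has a large value $f(S)$. It accesses $f$ through a value oracle and each $M_i$ through its own independence oracle, and queries them only on sets of elements that are explicitly stored in its memory (including the element that is being read). Its computational power is not bounded; an element of $\mathcal N$, a value of $f$, and a bit each take one unit of space. Let $\rho$ be the maximum of the ranks of $M_1,\dots,M_k$ (with $\rho:=1$ if all these ranks are $0$); $\rho$, $|\mathcal N|$ and the optimal value are not known to the algorithm in advance. There are absolute constants $C>0$ and $d\in\mathbb N$ such that for every $\varepsilon\in(0,1/7)$ and every $k\ge 2$ the following holds. 1. There is a deterministic single-pass data stream algorithm that, on every instance of $\mathtt{SMkM}$, outputs a common independent set $S$ with $f(T)\le (2+C\varepsilon)\,f(S)$ for every common independent set $T$ (that is, it is a $(2+O(\varepsilon))$-approximation),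 and uses space at most $$C\cdot\Big(\frac{k^{2\rho k}}{\varepsilon^{3}}\Big)^{\rho+1}\big(\log\rho+\log k+\log\varepsilon^{-1}\big)^{\rho+2}\rho ,$$ and also at most $C\,\big(k^{\rho^2k}\,\varepsilon^{-\rho}\big)^{d}$; in particular its space is $\mathrm{poly}(k^{\rho^2k},\varepsilon^{-\rho})$, independent of $|\mathcal N|$. 2. If $f$ is guaranteed to be monotone, there is such an algorithm with the same approximation guarantee and space at most $$C\cdot\Big(\frac{k^{\rho k}}{\varepsilon}\Big)^{\rho+1}\big(\log\rho+\log k+\log\varepsilon^{-1}\big)^{\rho+2}\rho .$$ -/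

import Mathlib

/-- An instance of submodular maximization subject to `k` matroid constraints whose elements are
drawn from `α`. The ground set is the (finite) set of elements of `stream`, listed in their order
of arrival; `f` is only constrained on subsets of the ground set. -/
structure SMkMInstance (α : Type*) [DecidableEq α] (k : ℕ) where
  /-- the elements of the ground set in order of arrival -/
  stream : List α
  /-- every element arrives exactly once -/
  nodup : stream.Nodup
  /-- the objective function -/
  f : Finset α → ℝ
  /-- the matroid constraints -/
  M : Fin k → Matroid α
  /-- all the matroids are defined over the ground set -/
  ground_eq : ∀ i, (M i).E = {u | u ∈ stream}
  /-- the objective function is non-negative -/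
  nonneg : ∀ S : Finset α, S ⊆ stream.toFinset → 0 ≤ f S
  /-- the objective function has diminishing returns -/
  submodular : ∀ A B : Finset α, A ⊆ B → B ⊆ stream.toFinset →
    ∀ u ∈ stream.toFinset \ B, f (insert u B) - f B ≤ f (insert u A) - f A

namespace SMkMInstance

variable {α : Type*} [DecidableEq α] {k : ℕ}

/-- The objective function is monotone over the ground set. -/
def IsMonotone (I : SMkMInstance α k) : Prop :=
  ∀ A B : Finset α, A ⊆ B → B ⊆ I.stream.toFinset → I.f A ≤ I.f B

/-- Common independent sets: the feasible solutions. -/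
def CommonIndep (I : SMkMInstance α k) (S : Finset α) : Prop :=
  ∀ i, (I.M i).Indep (S : Set α)

/-- The largest rank of a constraint matroid (all the ranks are finite, since the ground set is). -/
noncomputable def rank (I : SMkMInstance α k) : ℕ :=
  Finset.univ.sup fun i => (I.M i).eRank.toNat

end SMkMInstance

/-- A value oracle together with `k` independence oracles, one per matroid. -/
structure Oracles (α : Type*) (k : ℕ) where
  /-- the value oracle -/
  value : Finset α → ℝ
  /-- the independence oracles -/
  indep : Fin k → Finset α → Bool

open Classical in
/-- The oracles of an instance. -/
noncomputable def SMkMInstance.oracles {α : Type*} [DecidableEq α] {k : ℕ}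
    (I : SMkMInstance α k) : Oracles α k where
  value := I.f
  indep := fun i S => decide ((I.M i).Indep (S : Set α))

/-- A computation that adaptively queries the oracles, one query after the other, and finally
returns an object of type `β`. -/
inductive QueryProgram (α : Type*) (k : ℕ) (β : Type*) where
  | done (b : β) : QueryProgram α k β
  | value (S : Finset α) (next : ℝ → QueryProgram α k β) : QueryProgram α k β
  | indep (i : Fin k) (S : Finset α) (next : Bool → QueryProgram α k β) : QueryProgram α k β

namespace QueryProgram

variable {α : Type*} {k : ℕ} {β : Type*}

/-- The object returned when the queries are answered by `O`. -/
def result (O : Oracles α k) : QueryProgram α k β → β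
  | done b => b
  | value S next => (next (O.value S)).result O
  | indep i S next => (next (O.indep i S)).result O

/-- The number of queries made when they are answered by `O`. -/
def numQueries (O : Oracles α k) : QueryProgram α k β → ℕ
  | done _ => 0
  | value S next => (next (O.value S)).numQueries O + 1
  | indep i S next => (next (O.indep i S)).numQueries O + 1

/-- Only subsets of `A` are ever queried, and the returned object always satisfies `P`. -/
def Respects (A : Set α) (P : β → Prop) : QueryProgram α k β → Prop
  | done b => P b
  | value S next => (S : Set α) ⊆ A ∧ ∀ x, (next x).Respects A P
  | indep _ S next => (S : Set α) ⊆ A ∧ ∀ x, (next x).Respects A P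

end QueryProgram

/-- A cell of memory that is kept from one arrival to the next holds an element or a single bit. -/
inductive MemCell (α : Type*) where
  | elem (u : α) : MemCell α
  | bit (b : Bool) : MemCell α

/-- The set of elements that are explicitly stored in the memory `m`. -/
def storedElements {α : Type*} (m : List (MemCell α)) : Set α :=
  {u | MemCell.elem u ∈ m}

/-- A (deterministic) single-pass data stream algorithm with a value oracle and `k` independence
oracles. Its state between arrivals is the content of its memory. There is no bound on its
computational power, but an element of the stream can be used later on only if it is stored when it
arrives and kept ever since, and the oracles can be queried only on sets of elements that are
explicitly stored (or are just being read). -/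
structure DataStreamAlg (α : Type*) (k : ℕ) where
  /-- the content of the memory before the first element arrives -/
  init : List (MemCell α)
  /-- no element is stored before it arrives -/
  init_stored : storedElements init = ∅
  /-- the processing of an arriving element, which returns the new content of the memory -/
  update : List (MemCell α) → α → QueryProgram α k (List (MemCell α))
  update_respects : ∀ m u, (update m u).Respects (insert u (storedElements m))
    (fun m' => storedElements m' ⊆ insert u (storedElements m))
  /-- the computation of the returned solution at the end of the stream -/
  output : List (MemCell α) → QueryProgram α k (Finset α)
  output_respects : ∀ m, (output m).Respects (storedElements m)
    (fun S : Finset α => (S : Set α) ⊆ storedElements m)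

namespace DataStreamAlg

variable {α : Type*} {k : ℕ}

/-- The content of the memory after the elements of a list have arrived one by one. -/
def memoryAfter (A : DataStreamAlg α k) (O : Oracles α k) (l : List α) : List (MemCell α) :=
  l.foldl (fun m u => (A.update m u).result O) A.init

variable [DecidableEq α]

/-- The solution that the algorithm returns on an instance. -/
noncomputable def solution (A : DataStreamAlg α k) (I : SMkMInstance α k) : Finset α :=
  (A.output (A.memoryAfter I.oracles I.stream)).result I.oracles

/-- The algorithm returns a common independent set whose value is at least a `1 / c` fraction of
the value of every common independent set. -/
def Approximates (A : DataStreamAlg α k) (I : SMkMInstance α k) (c : ℝ) : Prop :=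
  I.CommonIndep (A.solution I) ∧
    ∀ T : Finset α, I.CommonIndep T → I.f T ≤ c * I.f (A.solution I)

/-- The algorithm never uses more than `s` units of space. An element, a bit and a value of `f` take
one unit each. While an element is processed, the space holds the memory, the element itself and the
answers to all the queries made so far during the processing; similarly for the computation of the
output. -/
def SpaceAtMost (A : DataStreamAlg α k) (I : SMkMInstance α k) (s : ℝ) : Prop :=
  (∀ (l : List α) (u : α), l ++ [u] <+: I.stream →
    (((A.memoryAfter I.oracles l).length + 1 +
      (A.update (A.memoryAfter I.oracles l) u).numQueries I.oracles : ℕ) : ℝ) ≤ s) ∧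
  (((A.memoryAfter I.oracles I.stream).length +
    (A.output (A.memoryAfter I.oracles I.stream)).numQueries I.oracles : ℕ) : ℝ) ≤ s

end DataStreamAlg

/-- `(k ^ (2ρk) / ε ^ 3) ^ (ρ + 1) * (log ρ + log k + log ε⁻¹) ^ (ρ + 2) * ρ` -/
noncomputable def generalSpaceBound (k ρ : ℕ) (ε : ℝ) : ℝ :=
  ((k : ℝ) ^ (2 * ρ * k) / ε ^ 3) ^ (ρ + 1) *
    (Real.log ρ + Real.log k + Real.log ε⁻¹) ^ (ρ + 2) * ρ

/-- `(k ^ (ρk) / ε) ^ (ρ + 1) * (log ρ + log k + log ε⁻¹) ^ (ρ + 2) * ρ` -/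
noncomputable def monotoneSpaceBound (k ρ : ℕ) (ε : ℝ) : ℝ :=
  ((k : ℝ) ^ (ρ * k) / ε) ^ (ρ + 1) *
    (Real.log ρ + Real.log k + Real.log ε⁻¹) ^ (ρ + 2) * ρ

/-! Fix an optimal solution `T`. The algorithm stores a tree of partial solutions, and the analysis
follows one branch `p`, with `S = taken p`, such that `S` together with the elements of `T` still to
arrive is common independent (`IsProgress`). When `u ∈ T` arrives, let `R` be `S` plus the later
elements of `T`, and search below `p` among stored elements whose rounded logarithmic gain (the key)
equals that of `u`. If the element `a` met there extends `R`, it can replace `u`. Otherwise `R`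
spans `a` in some matroid `i`, and the search moves to the child labelled `i`, which records `a` as
spanned in matroid `i`. All recorded sets stay in the closure of `R`, and `u` lies in none of these
closures; so if the search reaches a free place, `u` itself may be stored there
(`exists_mem_or_candidate`).

Equal keys mean that the chosen element gains at least `1 - ε` times the gain of `u`. By
submodularity, the gain of the arrived part of `T` over `S` is therefore paid for by `f(S) - f(∅)`,
which yields the factor 2 (`IsProgress.take`). Elements of tiny gain are skipped. Since the rank is
unknown, the cut-off uses the size of a basis of the elements seen so far in one matroid: the `n`-th
element of `T` then loses at most `2εf(T)/(n(n+1))`, and these losses telescope (`IsProgress.skip`).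

Without monotonicity, adding elements to `S ∪ T` might destroy value. So several searches run on
pairwise disjoint sets of elements; if none has room for `u`, they offer distinct replacements, and
by averaging one of them is nearly harmless (`hasHarmless_ceil`).

For the space, each recorded set is independent together with the last element of its branch. Hence
a search rejects at most `k(ρ-1)` elements along a branch and at most `ρ` elements are taken. The
keys lie in a window of logarithmic length (`exists_keys`), and each place of the tree holds one
element per key (`IsSearchTree.card_le`). -/

/-! ### Programs that ask a fixed list of queries. -/

namespace QueryProgram

variable {α : Type*} [DecidableEq α] {k : ℕ} {β : Type*}

/-- Ask the queries of two lists one after the other, record the answers in a table that is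
initially `O'`, and return a function of the table. -/
def ask (post : Oracles α k → β) :
    List (Finset α) → List (Fin k × Finset α) → Oracles α k → QueryProgram α k β
  | [], [], O' => done (post O')
  | S :: V, Q, O' => value S fun x => ask post V Q
      { O' with value := fun T => if T = S then x else O'.value T }
  | [], (i, S) :: Q, O' => indep i S fun b => ask post [] Q
      { O' with indep := fun j T => if j = i ∧ T = S then b else O'.indep j T }

/-- The alternative that an entry of the initial table is already correct carries the induction: a
later write stores a true answer, so it cannot spoil an entry. -/
theorem ask_nil_result (O : Oracles α k) (post : Oracles α k → β) (Q : List (Fin k × Finset α))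
    (O' : Oracles α k) : ∃ O'' : Oracles α k, (ask post [] Q O').result O = post O'' ∧
      O''.value = O'.value ∧
      ∀ i S, (i, S) ∈ Q ∨ O'.indep i S = O.indep i S → O''.indep i S = O.indep i S := by
  induction Q generalizing O' with
  | nil => exact ⟨O', by simp [ask, result], rfl, by simp⟩
  | cons q Q ih =>
    obtain ⟨i, S⟩ := q
    obtain ⟨O'', h1, h2, h3⟩ := ih
      { O' with indep := fun j T => if j = i ∧ T = S then O.indep i S else O'.indep j T }
    refine ⟨O'', by simpa [ask, result] using h1, h2, fun j T hjT => h3 j T ?_⟩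
    by_cases h : j = i ∧ T = S
    · right; simp [h]
    · rcases hjT with hjT | hjT
      · left
        rcases List.mem_cons.1 hjT with e | e
        · exact absurd (Prod.mk.inj e) h
        · exact e
      · right; simpa [h] using hjT

theorem ask_result (O : Oracles α k) (post : Oracles α k → β) (V : List (Finset α))
    (Q : List (Fin k × Finset α)) (O' : Oracles α k) :
    ∃ O'' : Oracles α k, (ask post V Q O').result O = post O'' ∧
      (∀ S, S ∈ V ∨ O'.value S = O.value S → O''.value S = O.value S) ∧
      ∀ i S, (i, S) ∈ Q ∨ O'.indep i S = O.indep i S → O''.indep i S = O.indep i S := by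
  induction V generalizing O' with
  | nil =>
    obtain ⟨O'', h1, h2, h3⟩ := ask_nil_result O post Q O'
    exact ⟨O'', h1, by simp [h2], h3⟩
  | cons S V ih =>
    obtain ⟨O'', h1, h2, h3⟩ := ih
      { O' with value := fun T => if T = S then O.value S else O'.value T }
    refine ⟨O'', by simpa [ask, result] using h1, fun T hT => h2 T ?_, h3⟩
    by_cases h : T = S
    · right; simp [h]
    · rcases hT with hT | hT
      · left; simpa [h] using hT
      · right; simpa [h] using hT

theorem ask_numQueries (O : Oracles α k) (post : Oracles α k → β) (V : List (Finset α))
    (Q : List (Fin k × Finset α)) (O' : Oracles α k) :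
    (ask post V Q O').numQueries O = V.length + Q.length := by
  induction V generalizing O' with
  | nil =>
    induction Q generalizing O' with
    | nil => simp [ask, numQueries]
    | cons q Q ih => obtain ⟨i, S⟩ := q; simp [ask, numQueries, ih]
  | cons S V ih => simp [ask, numQueries, ih]; omega

theorem ask_respects (post : Oracles α k → β) (A : Set α) (P : β → Prop) (V : List (Finset α))
    (Q : List (Fin k × Finset α)) (O' : Oracles α k) (hV : ∀ S ∈ V, (S : Set α) ⊆ A)
    (hQ : ∀ q ∈ Q, (q.2 : Set α) ⊆ A) (hP : ∀ O, P (post O)) :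
    (ask post V Q O').Respects A P := by
  induction V generalizing O' with
  | nil =>
    induction Q generalizing O' with
    | nil => simpa [ask, Respects] using hP _
    | cons q Q ih =>
      obtain ⟨i, S⟩ := q
      simp only [ask, Respects]
      exact ⟨hQ (i, S) (by simp), fun b => ih (fun q hq => hQ q (by simp [hq])) _⟩
  | cons S V ih =>
    simp only [ask, Respects]
    exact ⟨hV S (by simp), fun x => ih _ fun T hT => hV T (by simp [hT])⟩

end QueryProgram

/-! ### Prefix codes for the content of the memory. -/

/-- No codeword is a proper prefix of another one, even when followed by arbitrary cells. -/
def IsPrefixCode {α β : Type*} (enc : β → List (MemCell α)) : Prop :=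
  ∀ x y r s, enc x ++ r = enc y ++ s → x = y ∧ r = s

namespace MemCode

variable {α β γ : Type*}

/-- A number in unary. -/
def encNat (n : ℕ) : List (MemCell α) := List.replicate n (.bit true) ++ [.bit false]

theorem isPrefixCode_encNat : IsPrefixCode (encNat (α := α)) := by
  intro x
  induction x with
  | zero =>
    intro y r s h
    cases y with
    | zero => simpa [encNat] using h
    | succ y => simp [encNat, List.replicate_succ] at h
  | succ x ih =>
    intro y r s h
    cases y with
    | zero => simp [encNat, List.replicate_succ] at h
    | succ y =>
      have := ih y r s (by simpa [encNat, List.replicate_succ] using h)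
      simpa using this

/-- A label of a search word. -/
def encLabel {k : ℕ} : ℕ ⊕ Fin k → List (MemCell α)
  | .inl c => .bit true :: encNat c
  | .inr i => .bit false :: encNat i

theorem isPrefixCode_encLabel {k : ℕ} : IsPrefixCode (encLabel (α := α) (k := k)) := by
  rintro (c | i) (c' | i') r s h
  · simp only [encLabel, List.cons_append, List.cons.injEq, true_and] at h
    obtain ⟨h1, h2⟩ := isPrefixCode_encNat _ _ _ _ h
    exact ⟨by rw [h1], h2⟩
  · simp [encLabel] at h
  · simp [encLabel] at h
  · simp only [encLabel, List.cons_append, List.cons.injEq, true_and] at h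
    obtain ⟨h1, h2⟩ := isPrefixCode_encNat _ _ _ _ h
    exact ⟨by rw [Fin.ext h1], h2⟩

/-- An element. -/
def encElem (a : α) : List (MemCell α) := [.elem a]

theorem isPrefixCode_encElem : IsPrefixCode (encElem (α := α)) := by
  intro x y r s h
  simpa [encElem] using h

/-- Two objects one after the other. -/
def encPair (e : β → List (MemCell α)) (e' : γ → List (MemCell α)) (x : β × γ) :
    List (MemCell α) := e x.1 ++ e' x.2

theorem isPrefixCode_encPair {e : β → List (MemCell α)} {e' : γ → List (MemCell α)}
    (he : IsPrefixCode e) (he' : IsPrefixCode e') : IsPrefixCode (encPair e e') := by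
  rintro ⟨x, x'⟩ ⟨y, y'⟩ r s h
  simp only [encPair, List.append_assoc] at h
  obtain ⟨h1, h2⟩ := he _ _ _ _ h
  obtain ⟨h3, h4⟩ := he' _ _ _ _ h2
  exact ⟨by rw [h1, h3], h4⟩

/-- A list, each entry preceded by a set bit, terminated by an unset bit. -/
def encList (e : β → List (MemCell α)) : List β → List (MemCell α)
  | [] => [.bit false]
  | x :: l => .bit true :: (e x ++ encList e l)

theorem isPrefixCode_encList {e : β → List (MemCell α)} (he : IsPrefixCode e) :
    IsPrefixCode (encList e) := by
  intro x
  induction x with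
  | nil =>
    intro y r s h
    cases y with
    | nil => simpa [encList] using h
    | cons y l => simp [encList] at h
  | cons x l ih =>
    intro y r s h
    cases y with
    | nil => simp [encList] at h
    | cons y l' =>
      simp only [encList, List.cons_append, List.cons.injEq, List.append_assoc, true_and] at h
      obtain ⟨h1, h2⟩ := he _ _ _ _ h
      obtain ⟨h3, h4⟩ := ih _ _ _ h2
      exact ⟨by rw [h1, h3], h4⟩

theorem length_encList_le {e : β → List (MemCell α)} {l : List β} {n : ℕ}
    (h : ∀ x ∈ l, (e x).length ≤ n) : (encList e l).length ≤ l.length * (n + 1) + 1 := by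
  induction l with
  | nil => simp [encList]
  | cons x l ih =>
    have h1 := ih fun y hy => h y (by simp [hy])
    have h2 := h x (by simp)
    simp only [encList, List.length_cons, List.length_append, Nat.add_mul, one_mul] at *
    omega

theorem elem_mem_encNat (a : α) (n : ℕ) : MemCell.elem a ∉ encNat (α := α) n := by
  simp [encNat]

theorem elem_mem_encLabel {k : ℕ} (a : α) (x : ℕ ⊕ Fin k) : MemCell.elem a ∉ encLabel x := by
  cases x <;> simp [encLabel, elem_mem_encNat]

theorem elem_mem_encList {e : β → List (MemCell α)} {l : List β} {a : α} :
    MemCell.elem a ∈ encList e l ↔ ∃ x ∈ l, MemCell.elem a ∈ e x := by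
  induction l with
  | nil => simp [encList]
  | cons x l ih => simp [encList, ih]

end MemCode

/-! ### Branches of the search tree and the data read off from them. -/

/-- A branch of the search: a list of elements (the most recent one first), each with a label. The
label `inl c` of an element says that the element before it is taken into the solution and that
a new search is started, namely the `c`-th of several disjoint ones. The label `inr i` says that the
element before it is not taken, because it is spanned by the desired solution in matroid `i`. -/
abbrev SearchWord (α : Type*) (k : ℕ) := List ((ℕ ⊕ Fin k) × α)

namespace SearchWord

set_option linter.unusedSectionVars false

variable {α : Type*} [DecidableEq α] {k : ℕ}

/-- The last element (as a set), if there is one. -/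
def last : SearchWord α k → Finset α
  | [] => ∅
  | x :: _ => {x.2}

/-- The elements taken before the last element is considered. -/
def before : SearchWord α k → Finset α
  | [] => ∅
  | (.inl _, _) :: p => before p ∪ last p
  | (.inr _, _) :: p => before p

/-- The elements taken if the last element is taken. -/
def taken (w : SearchWord α k) : Finset α := before w ∪ last w

/-- The elements known to be spanned by the desired solution in each matroid, before the
last element is considered. -/
def spans : SearchWord α k → Fin k → Finset α
  | [], _ => ∅
  | (.inl _, _) :: p, _ => taken p
  | (.inr i, _) :: p, j => if j = i then spans p j ∪ last p else spans p j

/-- The part of a branch before the current search. -/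
def root : SearchWord α k → SearchWord α k
  | [] => []
  | (.inl _, _) :: p => p
  | (.inr _, _) :: p => root p

/-- The index of the current search. -/
def copy : SearchWord α k → ℕ
  | [] => 0
  | (.inl c, _) :: _ => c
  | (.inr _, _) :: p => copy p

/-- The number of elements that are not taken in the current search. -/
def numSpans : SearchWord α k → ℕ
  | [] => 0
  | (.inl _, _) :: _ => 0
  | (.inr _, _) :: p => numSpans p + 1

/-- The label of the last element. -/
def label (w : SearchWord α k) : Option (ℕ ⊕ Fin k) := w.head?.map Prod.fst

/-- The gain of taking the last element. -/
def weight (O : Oracles α k) (w : SearchWord α k) : ℝ := O.value (taken w) - O.value (before w)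

/-- The gain of taking the last element, on a rounded logarithmic scale. -/
noncomputable def key (ε : ℝ) (O : Oracles α k) (w : SearchWord α k) : ℤ :=
  ⌊Real.log (weight O w) / ε⌋

@[simp] theorem last_nil : last ([] : SearchWord α k) = ∅ := rfl
@[simp] theorem last_cons (x : (ℕ ⊕ Fin k) × α) (p : SearchWord α k) :
    last (x :: p) = {x.2} := rfl
@[simp] theorem before_nil : before ([] : SearchWord α k) = ∅ := rfl
@[simp] theorem before_inl (c : ℕ) (a : α) (p : SearchWord α k) :
    before ((.inl c, a) :: p) = taken p := rfl
@[simp] theorem before_inr (i : Fin k) (a : α) (p : SearchWord α k) :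
    before ((.inr i, a) :: p) = before p := rfl
@[simp] theorem taken_nil : taken ([] : SearchWord α k) = ∅ := by simp [taken]
theorem taken_cons (l : ℕ ⊕ Fin k) (a : α) (p : SearchWord α k) :
    taken ((l, a) :: p) = insert a (before ((l, a) :: p)) := by
  rw [taken, last_cons, Finset.union_comm, Finset.insert_eq]
@[simp] theorem spans_nil (i : Fin k) : spans ([] : SearchWord α k) i = ∅ := rfl
@[simp] theorem spans_inl (c : ℕ) (a : α) (p : SearchWord α k) (i : Fin k) :
    spans ((.inl c, a) :: p) i = taken p := rfl
theorem spans_inr (i : Fin k) (a : α) (p : SearchWord α k) (j : Fin k) :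
    spans ((.inr i, a) :: p) j = if j = i then spans p j ∪ last p else spans p j := rfl
@[simp] theorem root_inr (i : Fin k) (a : α) (p : SearchWord α k) :
    root ((.inr i, a) :: p) = root p := rfl
@[simp] theorem copy_inr (i : Fin k) (a : α) (p : SearchWord α k) :
    copy ((.inr i, a) :: p) = copy p := rfl
@[simp] theorem label_cons (x : (ℕ ⊕ Fin k) × α) (p : SearchWord α k) :
    label (x :: p) = some x.1 := rfl

/-- Together with `spans_congr`: these data belong to the place (label and parent), not to its
occupant, so a stored element can be compared with an arriving one. -/
theorem before_congr (l : ℕ ⊕ Fin k) (a b : α) (p : SearchWord α k) :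
    before ((l, a) :: p) = before ((l, b) :: p) := by cases l <;> rfl

theorem spans_congr (l : ℕ ⊕ Fin k) (a b : α) (p : SearchWord α k) :
    spans ((l, a) :: p) = spans ((l, b) :: p) := by cases l <;> rfl

theorem before_cons_eq (l : ℕ ⊕ Fin k) (a : α) (p : SearchWord α k) :
    before ((l, a) :: p) = taken p ∨ before ((l, a) :: p) = before p := by
  cases l <;> simp

theorem last_subset {w : SearchWord α k} {a : α} (h : a ∈ last w) : ∃ x ∈ w, x.2 = a := by
  cases w with
  | nil => simp at h
  | cons x p => exact ⟨x, by simp, by simpa [eq_comm] using h⟩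

theorem mem_of_mem_before {w : SearchWord α k} {a : α} (h : a ∈ before w) :
    ∃ x ∈ w.tail, x.2 = a := by
  induction w with
  | nil => simp at h
  | cons x p ih =>
    obtain ⟨l | i, b⟩ := x
    · rw [before_inl, taken, Finset.mem_union] at h
      rcases h with h | h
      · obtain ⟨x, hx, e⟩ := ih h
        exact ⟨x, List.mem_of_mem_tail hx, e⟩
      · exact last_subset h
    · obtain ⟨x, hx, e⟩ := ih (by simpa using h)
      exact ⟨x, List.mem_of_mem_tail hx, e⟩

theorem mem_of_mem_taken {w : SearchWord α k} {a : α} (h : a ∈ taken w) :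
    ∃ x ∈ w, x.2 = a := by
  rw [taken, Finset.mem_union] at h
  rcases h with h | h
  · obtain ⟨x, hx, e⟩ := mem_of_mem_before h
    exact ⟨x, List.mem_of_mem_tail hx, e⟩
  · exact last_subset h

theorem mem_of_mem_spans {w : SearchWord α k} {i : Fin k} {a : α} (h : a ∈ spans w i) :
    ∃ x ∈ w.tail, x.2 = a := by
  induction w with
  | nil => simp at h
  | cons x p ih =>
    obtain ⟨l | j, b⟩ := x
    · exact mem_of_mem_taken (by simpa using h)
    · have : a ∈ spans p i ∨ a ∈ last p := by
        rw [spans_inr] at h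
        split_ifs at h
        · simpa using h
        · exact .inl h
      rcases this with h | h
      · obtain ⟨x, hx, e⟩ := ih h
        exact ⟨x, List.mem_of_mem_tail hx, e⟩
      · exact last_subset h

theorem before_subset_spans (w : SearchWord α k) (i : Fin k) : before w ⊆ spans w i := by
  induction w with
  | nil => simp
  | cons x p ih =>
    obtain ⟨l | j, b⟩ := x
    · simp
    · rw [before_inr, spans_inr]
      split_ifs
      · exact ih.trans Finset.subset_union_left
      · exact ih

end SearchWord

/-! ### States, their encoding, and the update of a state. -/

/-- The search tree: a set of branches, together with a basis of the elements seen so far in one of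
the matroids and the most valuable feasible element seen so far. -/
@[ext] structure SearchState (α : Type*) (k : ℕ) where
  /-- the branches -/
  words : Finset (SearchWord α k)
  /-- a basis -/
  base : Finset α
  /-- the most valuable feasible element -/
  best : Option α

namespace SearchState

open SearchWord

variable {α : Type*} {k : ℕ}

/-- The elements that occur in a state. -/
def elems (s : SearchState α k) : Set α :=
  {a | (∃ w ∈ s.words, ∃ x ∈ w, x.2 = a) ∨ a ∈ s.base ∨ a ∈ s.best}

/-- The content of the memory in a given state. -/
noncomputable def encode (s : SearchState α k) : List (MemCell α) :=
  MemCode.encList (MemCode.encList (MemCode.encPair MemCode.encLabel MemCode.encElem))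
      s.words.toList ++
    (MemCode.encList MemCode.encElem s.base.toList ++
      MemCode.encList MemCode.encElem s.best.toList)

theorem encode_injective : Function.Injective (encode (α := α) (k := k)) := by
  intro s t h
  have h1 := MemCode.isPrefixCode_encList (MemCode.isPrefixCode_encList
    (MemCode.isPrefixCode_encPair MemCode.isPrefixCode_encLabel MemCode.isPrefixCode_encElem))
    _ _ _ _ h
  have h2 := MemCode.isPrefixCode_encList MemCode.isPrefixCode_encElem _ _ _ _ h1.2
  have h3 := MemCode.isPrefixCode_encList MemCode.isPrefixCode_encElem s.best.toList
    t.best.toList [] [] (by rw [h2.2])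
  refine SearchState.ext ?_ ?_ ?_
  · simpa using congrArg (Multiset.ofList ·) h1.1
  · simpa using congrArg (Multiset.ofList ·) h2.1
  · have := h3.1
    revert this
    cases s.best <;> cases t.best <;> simp

theorem storedElements_encode (s : SearchState α k) : storedElements s.encode = s.elems := by
  ext a
  simp only [storedElements, encode, elems, Set.mem_ofPred_eq, List.mem_append,
    MemCode.elem_mem_encList, MemCode.encPair, MemCode.elem_mem_encLabel, false_or,
    MemCode.encElem, List.mem_singleton, MemCell.elem.injEq, Finset.mem_toList,
    Option.mem_toList, Option.mem_def]
  simp [eq_comm]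

/-- The state before the first element arrives. -/
def initial : SearchState α k := ⟨∅, ∅, none⟩

theorem elems_initial : (initial : SearchState α k).elems = ∅ := by
  ext; simp [elems, initial]

open Classical in
/-- The state with a given content of the memory. -/
noncomputable def decode (m : List (MemCell α)) : SearchState α k :=
  if h : ∃ s : SearchState α k, s.encode = m then h.choose else initial

theorem decode_encode (s : SearchState α k) : decode s.encode = s := by
  have h : ∃ t : SearchState α k, t.encode = s.encode := ⟨s, rfl⟩
  rw [decode, dif_pos h]
  exact encode_injective h.choose_spec

/-- Memory contents that encode no state are decoded as `initial`, which has no elements; so the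
storage rules can be checked for every content, reachable or not. -/
theorem elems_decode (m : List (MemCell α)) :
    (decode m : SearchState α k).elems ⊆ storedElements m := by
  rw [decode]
  split_ifs with h
  · rw [← storedElements_encode, h.choose_spec]
  · simp [elems_initial]

variable [DecidableEq α]

/-- The branches that can be obtained by appending `u`. -/
def extensions (ℓ : ℕ → ℕ) (W : Finset (SearchWord α k)) (u : α) : Finset (SearchWord α k) :=
  (insert [] W).biUnion fun p =>
    ((Finset.range (ℓ (taken p).card)).disjSum Finset.univ).image fun l => (l, u) :: p

theorem mem_extensions {ℓ : ℕ → ℕ} {W : Finset (SearchWord α k)} {u : α}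
    {x : SearchWord α k} : x ∈ extensions ℓ W u ↔
      ∃ p, (p = [] ∨ p ∈ W) ∧ ∃ l, (∀ c, l = .inl c → c < ℓ (taken p).card) ∧
        x = (l, u) :: p := by
  simp only [extensions, Finset.mem_biUnion, Finset.mem_insert, Finset.mem_image]
  refine exists_congr fun p => and_congr_right fun _ => exists_congr fun l => ?_
  rw [eq_comm (a := x)]
  refine and_congr_left fun _ => ?_
  cases l <;> simp

/-- The requirements on a new branch: it improves the solution, the last element is not spanned in
any matroid by the set of elements recorded for it, no branch of the tree is in the same place, and
within a search the keys do not change. -/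
def IsCandidate (ε : ℝ) (O : Oracles α k) (W : Finset (SearchWord α k)) (x : SearchWord α k) :
    Prop :=
  0 < weight O x ∧ (∀ i, O.indep i (last x ∪ spans x i) = true) ∧
    (∀ y ∈ W, y.tail = x.tail → label y = label x → key ε O y ≠ key ε O x) ∧
    ∀ i, label x = some (.inr i) → x.tail ≠ [] ∧ key ε O x = key ε O x.tail

open Classical in
/-- The candidates for new branches. -/
noncomputable def candidates (ε : ℝ) (ℓ : ℕ → ℕ) (O : Oracles α k) (W : Finset (SearchWord α k))
    (u : α) : Finset (SearchWord α k) :=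
  (extensions ℓ W u).filter fun x => IsCandidate ε O W x

open Classical in
/-- The old branches and the new ones: among disjoint searches, an element enters only the first
possible one. -/
noncomputable def grown (ε : ℝ) (ℓ : ℕ → ℕ) (O : Oracles α k) (W : Finset (SearchWord α k))
    (u : α) : Finset (SearchWord α k) :=
  W ∪ (candidates ε ℓ O W u).filter fun x =>
    ∀ y ∈ candidates ε ℓ O W u, root y = root x → copy x ≤ copy y

/-- Branches whose key is too small for this threshold are given up. -/
noncomputable def threshold (ε : ℝ) (O : Oracles α k) (base : Finset α) (best : Option α) : ℝ :=
  ε * (O.value best.toFinset - O.value ∅) / (base.card * (base.card + 1))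

open Classical in
/-- The update of the most valuable feasible element. -/
noncomputable def newBest (O : Oracles α k) (b : Option α) (u : α) : Option α :=
  if (∀ i, O.indep i {u} = true) ∧ O.value b.toFinset < O.value {u} then some u else b

/-- The update of the basis. -/
def newBase (i₀ : Fin k) (O : Oracles α k) (B : Finset α) (u : α) : Finset α :=
  if O.indep i₀ (insert u B) then insert u B else B

open Classical in
/-- The branches that are not given up. -/
noncomputable def prune (ε τ : ℝ) (O : Oracles α k) (W : Finset (SearchWord α k)) :
    Finset (SearchWord α k) :=
  W.filter fun x => ∀ y ∈ W, y <:+ x → τ < Real.exp (ε * key ε O y)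

/-- The processing of an arriving element. -/
noncomputable def step (ε : ℝ) (ℓ : ℕ → ℕ) (i₀ : Fin k) (O : Oracles α k) (s : SearchState α k)
    (u : α) : SearchState α k where
  words := prune ε (threshold ε O (newBase i₀ O s.base u) (newBest O s.best u)) O
    (grown ε ℓ O s.words u)
  base := newBase i₀ O s.base u
  best := newBest O s.best u

/-- The sets whose value is needed for processing `u`. -/
def valueQueries (s : SearchState α k) (u : α) : Finset (Finset α) :=
  {∅, {u}, s.best.toFinset} ∪ (insert [] s.words).biUnion fun p =>
    {before p, taken p, insert u (before p), insert u (taken p)}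

/-- The sets whose independence is needed for processing `u`. -/
def indepQueries (i₀ : Fin k) (s : SearchState α k) (u : α) : Finset (Fin k × Finset α) :=
  insert (i₀, insert u s.base) <| (Finset.univ ×ˢ insert [] s.words).biUnion fun q =>
    {(q.1, insert u (spans q.2 q.1)), (q.1, insert u (spans q.2 q.1 ∪ last q.2)),
      (q.1, insert u (taken q.2))}

/-! ### The update depends only on the answers to the listed queries. -/

section Locality

variable {ε : ℝ} {ℓ : ℕ → ℕ} {i₀ : Fin k} {O O' : Oracles α k} {s : SearchState α k} {u : α}

theorem weight_eq_of_agree (hV : ∀ S ∈ valueQueries s u, O'.value S = O.value S)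
    {x : SearchWord α k} (hx : x ∈ s.words ∨ x ∈ extensions ℓ s.words u) :
    weight O' x = weight O x := by
  have key : ∀ p ∈ insert [] s.words, ∀ S ∈ ({before p, taken p, insert u (before p),
      insert u (taken p)} : Finset (Finset α)), O'.value S = O.value S := fun p hp S hS =>
    hV S (Finset.mem_union_right _ (Finset.mem_biUnion.2 ⟨p, hp, hS⟩))
  rcases hx with hx | hx
  · rw [weight, weight, key x (by simp [hx]) _ (by simp), key x (by simp [hx]) _ (by simp)]
  · obtain ⟨p, hp, l, -, rfl⟩ := mem_extensions.1 hx
    have hp' : p ∈ insert [] s.words := by simpa using hp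
    rw [weight, weight, taken_cons]
    rcases before_cons_eq l u p with e | e <;> rw [e] <;>
      rw [key p hp' _ (by simp), key p hp' _ (by simp)]

theorem isCandidate_iff_of_agree (hV : ∀ S ∈ valueQueries s u, O'.value S = O.value S)
    (hQ : ∀ q ∈ indepQueries i₀ s u, O'.indep q.1 q.2 = O.indep q.1 q.2)
    {x : SearchWord α k} (hx : x ∈ extensions ℓ s.words u) :
    IsCandidate ε O' s.words x ↔ IsCandidate ε O s.words x := by
  have hw : ∀ y, y ∈ s.words ∨ y ∈ extensions ℓ s.words u → key ε O' y = key ε O y :=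
    fun y hy => by rw [key, key, weight_eq_of_agree hV hy]
  have hind : ∀ i, O'.indep i (last x ∪ spans x i) = O.indep i (last x ∪ spans x i) := by
    intro i
    obtain ⟨p, hp, l, -, rfl⟩ := mem_extensions.1 hx
    refine hQ (i, _) (Finset.mem_insert_of_mem (Finset.mem_biUnion.2 ⟨(i, p), by simpa using hp, ?_⟩))
    rw [last_cons, ← Finset.insert_eq]
    -- The three sets listed per branch cover a label `inl`, where `taken p` is recorded, and a
    -- label `inr j`, where `last p` is added to the record of matroid `j` only.
    rcases l with c | j
    · simp
    · rw [spans_inr]; split_ifs <;> simp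
  unfold IsCandidate
  rw [weight_eq_of_agree hV (.inr hx)]
  simp only [hind, hw x (.inr hx)]
  refine and_congr_right fun _ => and_congr_right fun _ => and_congr ?_ ?_
  · exact forall₂_congr fun y hy => by rw [hw y (.inl hy)]
  · refine forall_congr' fun i => forall_congr' fun _ => and_congr_right fun hne => ?_
    obtain ⟨p, hp, l, -, rfl⟩ := mem_extensions.1 hx
    rw [List.tail_cons, hw p (.inl (hp.resolve_left hne))]

open Classical in
theorem grown_subset : grown ε ℓ O s.words u ⊆ s.words ∪ extensions ℓ s.words u := by
  exact Finset.union_subset_union_right ((Finset.filter_subset _ _).trans (Finset.filter_subset _ _))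

open Classical in
theorem step_eq_of_agree (hV : ∀ S ∈ valueQueries s u, O'.value S = O.value S)
    (hQ : ∀ q ∈ indepQueries i₀ s u, O'.indep q.1 q.2 = O.indep q.1 q.2) :
    step ε ℓ i₀ O' s u = step ε ℓ i₀ O s u := by
  have hv0 : O'.value ∅ = O.value ∅ := hV _ (by simp [valueQueries])
  have hvu : O'.value {u} = O.value {u} := hV _ (by simp [valueQueries])
  have hvb : O'.value s.best.toFinset = O.value s.best.toFinset := hV _ (by simp [valueQueries])
  have hi : ∀ i, O'.indep i {u} = O.indep i {u} := fun i =>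
    hQ (i, {u}) (Finset.mem_insert_of_mem (Finset.mem_biUnion.2 ⟨(i, []), by simp, by simp⟩))
  have hbest : newBest O' s.best u = newBest O s.best u := by
    simp only [newBest, hi, hvu, hvb]
  have hbase : newBase i₀ O' s.base u = newBase i₀ O s.base u := by
    have := hQ (i₀, insert u s.base) (by simp [indepQueries])
    simp only at this
    simp only [newBase, this]
  have hthr : threshold ε O' (newBase i₀ O s.base u) (newBest O s.best u) =
      threshold ε O (newBase i₀ O s.base u) (newBest O s.best u) := by
    have : O'.value (newBest O s.best u).toFinset = O.value (newBest O s.best u).toFinset := by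
      unfold newBest; split_ifs
      · simpa using hvu
      · exact hvb
    rw [threshold, threshold, this, hv0]
  have hcand : candidates ε ℓ O' s.words u = candidates ε ℓ O s.words u :=
    Finset.filter_congr fun x hx => isCandidate_iff_of_agree hV hQ hx
  have hgrown : grown ε ℓ O' s.words u = grown ε ℓ O s.words u := by
    unfold grown; rw [hcand]
  have hk : ∀ y ∈ grown ε ℓ O s.words u, key ε O' y = key ε O y := fun y hy => by
    rw [key, key, weight_eq_of_agree hV (Finset.mem_union.1 (grown_subset hy))]
  unfold step
  rw [hbest, hbase, hthr, hgrown]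
  congr 1
  refine Finset.filter_congr fun x _ => forall₂_congr fun y hy => ?_
  rw [hk y hy]

end Locality

theorem elems_step (ε : ℝ) (ℓ : ℕ → ℕ) (i₀ : Fin k) (O : Oracles α k) (s : SearchState α k)
    (u : α) : (step ε ℓ i₀ O s u).elems ⊆ insert u s.elems := by
  rintro a (⟨w, hw, x, hx, rfl⟩ | ha | ha)
  · have hw' := grown_subset (Finset.mem_of_mem_filter w hw)
    rcases Finset.mem_union.1 hw' with h | h
    · exact .inr (.inl ⟨w, h, x, hx, rfl⟩)
    · obtain ⟨p, hp, l, -, rfl⟩ := mem_extensions.1 h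
      rcases List.mem_cons.1 hx with rfl | hx
      · exact .inl rfl
      · rcases hp with rfl | hp
        · simp at hx
        · exact .inr (.inl ⟨p, hp, x, hx, rfl⟩)
  · simp only [step, newBase] at ha
    split_ifs at ha
    · rcases Finset.mem_insert.1 ha with rfl | ha
      · exact .inl rfl
      · exact .inr (.inr (.inl ha))
    · exact .inr (.inr (.inl ha))
  · simp only [step, newBest] at ha
    split_ifs at ha
    · left; simpa [eq_comm] using ha
    · exact .inr (.inr (.inr ha))

theorem coe_taken_subset {s : SearchState α k} {p : SearchWord α k}
    (hp : p ∈ insert [] s.words) : (taken p : Set α) ⊆ s.elems := by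
  intro a ha
  obtain ⟨x, hx, e⟩ := mem_of_mem_taken (Finset.mem_coe.1 ha)
  rcases Finset.mem_insert.1 hp with rfl | hp
  · simp at hx
  · exact .inl ⟨p, hp, x, hx, e⟩

theorem coe_spans_subset {s : SearchState α k} {p : SearchWord α k} (i : Fin k)
    (hp : p ∈ insert [] s.words) : (spans p i : Set α) ⊆ s.elems := by
  intro a ha
  obtain ⟨x, hx, e⟩ := mem_of_mem_spans (Finset.mem_coe.1 ha)
  rcases Finset.mem_insert.1 hp with rfl | hp
  · simp at hx
  · exact .inl ⟨p, hp, x, List.mem_of_mem_tail hx, e⟩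

theorem coe_before_subset {s : SearchState α k} {p : SearchWord α k}
    (hp : p ∈ insert [] s.words) : (before p : Set α) ⊆ s.elems :=
  (Finset.coe_subset.2 Finset.subset_union_left).trans (coe_taken_subset hp)

theorem coe_last_subset {s : SearchState α k} {p : SearchWord α k}
    (hp : p ∈ insert [] s.words) : (last p : Set α) ⊆ s.elems :=
  (Finset.coe_subset.2 Finset.subset_union_right).trans (coe_taken_subset hp)

theorem valueQueries_subset {s : SearchState α k} {u : α} {S : Finset α}
    (hS : S ∈ valueQueries s u) : (S : Set α) ⊆ insert u s.elems := by
  simp only [valueQueries, Finset.mem_union, Finset.mem_biUnion] at hS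
  rcases hS with hS | ⟨p, hp, hS⟩
  · simp only [Finset.mem_insert, Finset.mem_singleton] at hS
    rcases hS with rfl | rfl | rfl
    · simp
    · simp
    · intro a ha
      exact .inr (.inr (.inr (by simpa using ha)))
  · have h1 := coe_before_subset hp
    have h2 := coe_taken_subset hp
    simp only [Finset.mem_insert, Finset.mem_singleton] at hS
    rcases hS with rfl | rfl | rfl | rfl
    · exact h1.trans (Set.subset_insert _ _)
    · exact h2.trans (Set.subset_insert _ _)
    · rw [Finset.coe_insert]; exact Set.insert_subset_insert h1
    · rw [Finset.coe_insert]; exact Set.insert_subset_insert h2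

theorem indepQueries_subset {i₀ : Fin k} {s : SearchState α k} {u : α} {q : Fin k × Finset α}
    (hq : q ∈ indepQueries i₀ s u) : (q.2 : Set α) ⊆ insert u s.elems := by
  simp only [indepQueries, Finset.mem_insert, Finset.mem_biUnion, Finset.mem_product] at hq
  rcases hq with rfl | ⟨⟨i, p⟩, ⟨-, hp⟩, hq⟩
  · rw [Finset.coe_insert]
    exact Set.insert_subset_insert fun a ha => .inr (.inl ha)
  · have hp' := Finset.mem_insert.2 hp
    have h1 := coe_spans_subset i hp'
    have h2 := coe_last_subset hp'
    have h3 := coe_taken_subset hp'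
    simp only [Finset.mem_singleton] at hq
    rcases hq with rfl | rfl | rfl
    · simp only [Finset.coe_insert]; exact Set.insert_subset_insert h1
    · simp only [Finset.coe_insert, Finset.coe_union]
      exact Set.insert_subset_insert (Set.union_subset h1 h2)
    · simp only [Finset.coe_insert]; exact Set.insert_subset_insert h3

/-- The best solution of the tree. -/
noncomputable def bestSolution (O : Oracles α k) (s : SearchState α k) : Finset α :=
  taken (Finset.exists_max_image (insert [] s.words) (fun w => O.value (taken w))
    (Finset.insert_nonempty _ _)).choose

theorem bestSolution_eq (O : Oracles α k) (s : SearchState α k) :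
    ∃ w ∈ insert [] s.words, bestSolution O s = taken w :=
  ⟨_, (Finset.exists_max_image (insert [] s.words) (fun w => O.value (taken w))
    (Finset.insert_nonempty _ _)).choose_spec.1, rfl⟩

theorem le_bestSolution (O : Oracles α k) (s : SearchState α k) {w : SearchWord α k}
    (hw : w ∈ insert [] s.words) : O.value (taken w) ≤ O.value (bestSolution O s) :=
  (Finset.exists_max_image (insert [] s.words) (fun w => O.value (taken w))
    (Finset.insert_nonempty _ _)).choose_spec.2 w hw

/-! ### The algorithm and its run. -/

/-- A table of answers before any query is asked. -/
def emptyTable : Oracles α k := ⟨fun _ => 0, fun _ _ => false⟩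

/-- The algorithm that maintains the search tree. -/
noncomputable def alg (ε : ℝ) (ℓ : ℕ → ℕ) (i₀ : Fin k) : DataStreamAlg α k where
  init := (initial : SearchState α k).encode
  init_stored := by rw [storedElements_encode, elems_initial]
  update m u := QueryProgram.ask (fun O => (step ε ℓ i₀ O (decode m) u).encode)
    (valueQueries (decode m) u).toList (indepQueries i₀ (decode m) u).toList emptyTable
  update_respects m u := by
    have h : insert u (decode m : SearchState α k).elems ⊆ insert u (storedElements m) :=
      Set.insert_subset_insert (elems_decode m)
    refine QueryProgram.ask_respects _ _ _ _ _ _ (fun S hS => ?_) (fun q hq => ?_) fun O => ?_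
    · exact (valueQueries_subset (Finset.mem_toList.1 hS)).trans h
    · exact (indepQueries_subset (Finset.mem_toList.1 hq)).trans h
    · rw [storedElements_encode]
      exact (elems_step _ _ _ _ _ _).trans h
  output m := QueryProgram.ask (fun O => bestSolution O (decode m))
    ((insert [] (decode m).words).image taken).toList [] emptyTable
  output_respects m := by
    have h := elems_decode (k := k) m
    refine QueryProgram.ask_respects _ _ _ _ _ _ (fun S hS => ?_) (by simp) fun O => ?_
    · obtain ⟨p, hp, rfl⟩ := Finset.mem_image.1 (Finset.mem_toList.1 hS)
      exact (coe_taken_subset hp).trans h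
    · obtain ⟨p, hp, e⟩ := bestSolution_eq O (decode m)
      rw [e]
      exact (coe_taken_subset hp).trans h

/-- The state after the elements of a list have arrived one by one. -/
noncomputable def stateAfter (ε : ℝ) (ℓ : ℕ → ℕ) (i₀ : Fin k) (O : Oracles α k) (l : List α) :
    SearchState α k := l.foldl (step ε ℓ i₀ O) initial

theorem stateAfter_append (ε : ℝ) (ℓ : ℕ → ℕ) (i₀ : Fin k) (O : Oracles α k) (l : List α)
    (u : α) : stateAfter ε ℓ i₀ O (l ++ [u]) = step ε ℓ i₀ O (stateAfter ε ℓ i₀ O l) u := by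
  simp [stateAfter]

/-- The table filled by `ask` agrees with the true oracles on every queried set, so locality makes
each update equal to `step` run with the true oracles. The analysis can then ignore memory cells. -/
theorem memoryAfter_alg (ε : ℝ) (ℓ : ℕ → ℕ) (i₀ : Fin k) (O : Oracles α k) (l : List α) :
    (alg ε ℓ i₀).memoryAfter O l = (stateAfter ε ℓ i₀ O l).encode := by
  induction l using List.reverseRecOn with
  | nil => rfl
  | append_singleton l u ih =>
    have h : (alg ε ℓ i₀).memoryAfter O (l ++ [u]) =
        ((alg ε ℓ i₀).update ((alg ε ℓ i₀).memoryAfter O l) u).result O := by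
      simp [DataStreamAlg.memoryAfter]
    rw [h, ih, stateAfter_append]
    simp only [alg, decode_encode]
    set s := stateAfter ε ℓ i₀ O l
    obtain ⟨O', h1, h2, h3⟩ := QueryProgram.ask_result O (fun O => (step ε ℓ i₀ O s u).encode)
      (valueQueries s u).toList (indepQueries i₀ s u).toList emptyTable
    rw [h1, step_eq_of_agree (fun S hS => h2 S (.inl (by simpa using hS)))
      fun q hq => h3 q.1 q.2 (.inl (by simpa using hq))]

theorem solution_alg (ε : ℝ) (ℓ : ℕ → ℕ) (i₀ : Fin k) (I : SMkMInstance α k) :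
    (∃ w ∈ insert [] (stateAfter ε ℓ i₀ I.oracles I.stream).words,
      (alg ε ℓ i₀).solution I = taken w) ∧
    ∀ w ∈ insert [] (stateAfter ε ℓ i₀ I.oracles I.stream).words,
      I.f (taken w) ≤ I.f ((alg ε ℓ i₀).solution I) := by
  rw [DataStreamAlg.solution, memoryAfter_alg]
  simp only [alg, decode_encode]
  set s := stateAfter ε ℓ i₀ I.oracles I.stream
  obtain ⟨O', h1, h2, -⟩ := QueryProgram.ask_result I.oracles (fun O => bestSolution O s)
    ((insert [] s.words).image taken).toList [] emptyTable
  rw [h1]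
  have h : ∀ w ∈ insert [] s.words, O'.value (taken w) = I.f (taken w) := fun w hw =>
    h2 _ (.inl (Finset.mem_toList.2 (Finset.mem_image_of_mem _ hw)))
  obtain ⟨w, hw, e⟩ := bestSolution_eq O' s
  refine ⟨⟨w, hw, e⟩, fun v hv => ?_⟩
  have := le_bestSolution O' s hv
  rwa [e, h v hv, h w hw, ← e] at this

end SearchState

/-! ### Independence and rank of an instance. -/

namespace SMkMInstance

variable {α : Type*} [DecidableEq α] {k : ℕ} (I : SMkMInstance α k)

theorem oracles_indep {i : Fin k} {S : Finset α} :
    I.oracles.indep i S = true ↔ (I.M i).Indep (S : Set α) := by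
  simp [oracles]

theorem notMem_of_prefix {l : List α} {u : α} (h : l ++ [u] <+: I.stream) : u ∉ l := by
  have := h.sublist.nodup I.nodup
  rw [List.nodup_append] at this
  exact fun hu => this.2.2 u hu u (by simp) rfl

theorem CommonIndep.subset {S T : Finset α} (hT : I.CommonIndep T) (h : S ⊆ T) :
    I.CommonIndep S := fun i => (hT i).subset (by exact_mod_cast h)

theorem subset_of_indep {i : Fin k} {S : Finset α} (h : (I.M i).Indep (S : Set α)) :
    S ⊆ I.stream.toFinset := by
  intro a ha
  have := h.subset_ground (Finset.mem_coe.2 ha)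
  rw [I.ground_eq] at this
  simpa using this

theorem indep_card_le {i : Fin k} {S : Finset α} (h : (I.M i).Indep (S : Set α)) :
    S.card ≤ I.rank := by
  have hfin : (I.M i).E.Finite := by
    rw [I.ground_eq]
    exact (I.stream.toFinset.finite_toSet).subset fun a ha => by simpa using ha
  have h1 : (S : Set α).encard ≤ (I.M i).eRank := h.encard_le_eRank
  have h2 : (I.M i).eRank ≠ ⊤ := by
    refine ne_top_of_le_ne_top ?_ (I.M i).eRank_le_encard_ground
    exact Set.encard_ne_top_iff.2 hfin
  rw [Set.encard_coe_eq_coe_finsetCard] at h1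
  have h3 : S.card ≤ (I.M i).eRank.toNat := by
    have := ENat.toNat_le_toNat h1 h2
    simpa using this
  exact h3.trans (Finset.le_sup (f := fun i => (I.M i).eRank.toNat) (Finset.mem_univ i))

end SMkMInstance

/-! ### Invariants of the tree, of the basis and of the best element. -/

namespace SearchState

open SearchWord

variable {α : Type*} [DecidableEq α] {k : ℕ}

/-- The properties of a search tree after the elements of `l` have arrived. -/
structure IsSearchTree (ε : ℝ) (ℓ : ℕ → ℕ) (I : SMkMInstance α k) (l : List α)
    (W : Finset (SearchWord α k)) : Prop where
  mem : ∀ w ∈ W, ∀ x ∈ w, x.2 ∈ l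
  nil_notMem : [] ∉ W
  tail_mem : ∀ x p, x :: p ∈ W → p = [] ∨ p ∈ W
  indep : ∀ w ∈ W, ∀ i, (I.M i).Indep ((last w ∪ spans w i : Finset α) : Set α)
  notMem_spans : ∀ x p, x :: p ∈ W → ∀ i, x.2 ∉ spans (x :: p) i
  copy_lt : ∀ c a p, (.inl c, a) :: p ∈ W → c < ℓ (taken p).card
  key_eq : ∀ i a p, (.inr i, a) :: p ∈ W →
    p ≠ [] ∧ key ε I.oracles ((.inr i, a) :: p) = key ε I.oracles p
  unique : ∀ b a a' p, (b, a) :: p ∈ W → (b, a') :: p ∈ W →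
    key ε I.oracles ((b, a) :: p) = key ε I.oracles ((b, a') :: p) → a = a'
  -- Searches with the same root but different indices share no element. This makes the replacements
  -- they offer distinct.
  disjoint : ∀ v ∈ W, ∀ w ∈ W, last v = last w → root v = root w → copy v = copy w
  weight_pos : ∀ w ∈ W, 0 < weight I.oracles w

variable {ε : ℝ} {ℓ : ℕ → ℕ} {I : SMkMInstance α k} {l : List α} {u : α}
  {W : Finset (SearchWord α k)}

theorem mem_candidates {O : Oracles α k} {x : SearchWord α k} :
    x ∈ candidates ε ℓ O W u ↔ x ∈ extensions ℓ W u ∧ IsCandidate ε O W x := by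
  classical
  simp [candidates]

theorem mem_grown {O : Oracles α k} {x : SearchWord α k} :
    x ∈ grown ε ℓ O W u ↔ x ∈ W ∨ x ∈ candidates ε ℓ O W u ∧
      ∀ y ∈ candidates ε ℓ O W u, root y = root x → copy x ≤ copy y := by
  classical
  simp only [grown, Finset.mem_union, Finset.mem_filter]

theorem mem_prune {τ : ℝ} {O : Oracles α k} {x : SearchWord α k} :
    x ∈ prune ε τ O W ↔ x ∈ W ∧ ∀ y ∈ W, y <:+ x → τ < Real.exp (ε * key ε O y) := by
  classical
  simp only [prune, Finset.mem_filter]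

theorem IsSearchTree.mem_spans {W : Finset (SearchWord α k)} (h : IsSearchTree ε ℓ I l W)
    {x p} (hx : p = [] ∨ p ∈ W) {i : Fin k} {a : α} (ha : a ∈ spans (x :: p) i) : a ∈ l := by
  obtain ⟨y, hy, rfl⟩ := mem_of_mem_spans ha
  rcases hx with rfl | hx
  · simp at hy
  · exact h.mem p hx y hy

/-- Since `u` is new, no old branch ends in it and no record contains it; the remaining properties
are built into `IsCandidate`. Disjointness holds because only candidates of minimal index for their
root are added. -/
theorem IsSearchTree.grown (h : IsSearchTree ε ℓ I l W) (hu : u ∉ l) :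
    IsSearchTree ε ℓ I (l ++ [u]) (grown ε ℓ I.oracles W u) := by
  have hnew : ∀ x, x ∈ SearchState.grown ε ℓ I.oracles W u → x ∈ W ∨
      (∃ p, (p = [] ∨ p ∈ W) ∧ ∃ b, (∀ c, b = .inl c → c < ℓ (taken p).card) ∧
        x = (b, u) :: p) ∧ IsCandidate ε I.oracles W x ∧
        ∀ y ∈ candidates ε ℓ I.oracles W u, root y = root x → copy x ≤ copy y := by
    intro x hx
    rcases mem_grown.1 hx with hx | ⟨hx, hmin⟩
    · exact .inl hx
    · obtain ⟨hx1, hx2⟩ := mem_candidates.1 hx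
      exact .inr ⟨mem_extensions.1 hx1, hx2, hmin⟩
  have hW : ∀ {p}, p ∈ W → p ∈ SearchState.grown ε ℓ I.oracles W u := fun hp =>
    mem_grown.2 (.inl hp)
  have hlast : ∀ w ∈ W, last w ≠ {u} := by
    intro w hw e
    obtain ⟨x, hx, e⟩ := last_subset (w := w) (a := u) (by simp [e])
    exact hu (e ▸ h.mem w hw x hx)
  refine ⟨?_, ?_, ?_, ?_, ?_, ?_, ?_, ?_, ?_, ?_⟩
  · intro w hw x hx
    rcases hnew w hw with hw | ⟨⟨p, hp, b, -, rfl⟩, -⟩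
    · simp [h.mem w hw x hx]
    · rcases List.mem_cons.1 hx with rfl | hx
      · simp
      · rcases hp with rfl | hp
        · simp at hx
        · simp [h.mem p hp x hx]
  · intro hn
    rcases hnew _ hn with hw | ⟨⟨p, hp, b, -, e⟩, -⟩
    · exact h.nil_notMem hw
    · cases e
  · intro x p hw
    rcases hnew _ hw with hw | ⟨⟨p, hp, b, -, e⟩, -⟩
    · exact (h.tail_mem x p hw).imp_right hW
    · cases e
      exact hp.imp_right hW
  · intro w hw i
    rcases hnew _ hw with hw | ⟨-, hc, -⟩
    · exact h.indep w hw i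
    · exact I.oracles_indep.1 (hc.2.1 i)
  · intro x p hw i
    rcases hnew _ hw with hw | ⟨⟨p, hp, b, -, e⟩, -⟩
    · exact h.notMem_spans x p hw i
    · cases e
      exact fun ha => hu (h.mem_spans hp ha)
  · intro c a p hw
    rcases hnew _ hw with hw | ⟨⟨p, hp, b, hb, e⟩, -⟩
    · exact h.copy_lt c a p hw
    · cases e
      exact hb c rfl
  · intro i a p hw
    rcases hnew _ hw with hw | ⟨⟨p, hp, b, hb, e⟩, hc, -⟩
    · exact h.key_eq i a p hw
    · cases e
      exact hc.2.2.2 i rfl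
  · intro b a a' p hx hy hk
    rcases hnew _ hx with hx | ⟨⟨p, hp, b, hb, e⟩, hc, -⟩
    · rcases hnew _ hy with hy | ⟨⟨p, hp, b, hb, e⟩, hc, -⟩
      · exact h.unique b a a' p hx hy hk
      · exact absurd hk (hc.2.2.1 _ hx rfl rfl)
    · rcases hnew _ hy with hy | ⟨⟨p', hp', b', hb', e'⟩, hc, -⟩
      · exact absurd hk.symm (hc.2.2.1 _ hy rfl rfl)
      · cases e; cases e'; rfl
  · intro v hv w hw hl hr
    rcases mem_grown.1 hv with hv | ⟨hv, hv'⟩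
    · rcases mem_grown.1 hw with hw | ⟨hw, hw'⟩
      · exact h.disjoint v hv w hw hl hr
      · obtain ⟨p, hp, b, -, rfl⟩ := mem_extensions.1 (mem_candidates.1 hw).1
        exact absurd hl (hlast v hv)
    · rcases mem_grown.1 hw with hw | ⟨hw, hw'⟩
      · obtain ⟨p, hp, b, -, rfl⟩ := mem_extensions.1 (mem_candidates.1 hv).1
        exact absurd hl.symm (hlast w hw)
      · exact le_antisymm (hv' w hw hr.symm) (hw' v hv hr)
  · intro w hw
    rcases hnew _ hw with hw | ⟨-, hc, -⟩
    · exact h.weight_pos w hw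
    · exact hc.1

/-- Giving up a branch gives up all its extensions as well, so the tree stays closed under passing
to the parent. -/
theorem IsSearchTree.prune (h : IsSearchTree ε ℓ I l W) (τ : ℝ) :
    IsSearchTree ε ℓ I l (prune ε τ I.oracles W) where
  mem w hw := h.mem w (mem_prune.1 hw).1
  nil_notMem hw := h.nil_notMem (mem_prune.1 hw).1
  tail_mem x p hw := (h.tail_mem x p (mem_prune.1 hw).1).imp_right fun hp =>
    mem_prune.2 ⟨hp, fun y hy hyp => (mem_prune.1 hw).2 y hy (hyp.trans (List.suffix_cons x p))⟩
  indep w hw := h.indep w (mem_prune.1 hw).1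
  notMem_spans x p hw := h.notMem_spans x p (mem_prune.1 hw).1
  copy_lt c a p hw := h.copy_lt c a p (mem_prune.1 hw).1
  key_eq i a p hw := h.key_eq i a p (mem_prune.1 hw).1
  unique b a a' p hw hw' := h.unique b a a' p (mem_prune.1 hw).1 (mem_prune.1 hw').1
  disjoint v hv w hw := h.disjoint v (mem_prune.1 hv).1 w (mem_prune.1 hw).1
  weight_pos w hw := h.weight_pos w (mem_prune.1 hw).1

theorem isSearchTree_stateAfter (ε : ℝ) (ℓ : ℕ → ℕ) (i₀ : Fin k) (I : SMkMInstance α k)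
    {l : List α} (hl : l <+: I.stream) :
    IsSearchTree ε ℓ I l (stateAfter ε ℓ i₀ I.oracles l).words := by
  induction l using List.reverseRecOn with
  | nil => constructor <;> simp [stateAfter, initial]
  | append_singleton l u ih =>
    rw [stateAfter_append]
    exact ((ih ((List.prefix_append _ _).trans hl)).grown (I.notMem_of_prefix hl)).prune _

/-- The properties of the stored basis. -/
theorem base_stateAfter (ε : ℝ) (ℓ : ℕ → ℕ) (i₀ : Fin k) (I : SMkMInstance α k)
    {l : List α} (hl : l <+: I.stream) :
    (I.M i₀).Indep ((stateAfter ε ℓ i₀ I.oracles l).base : Set α) ∧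
    ∀ a ∈ l, a ∈ (I.M i₀).closure ((stateAfter ε ℓ i₀ I.oracles l).base : Set α) := by
  induction l using List.reverseRecOn with
  | nil => simp [stateAfter, initial]
  | append_singleton l u ih =>
    obtain ⟨h1, h2⟩ := ih ((List.prefix_append _ _).trans hl)
    rw [stateAfter_append]
    set s := stateAfter ε ℓ i₀ I.oracles l
    have huE : u ∈ (I.M i₀).E := by
      rw [I.ground_eq]
      exact hl.subset (by simp)
    have hlE : ∀ a ∈ l, a ∈ (I.M i₀).E := fun a ha => by
      rw [I.ground_eq]
      exact hl.subset (by simp [ha])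
    simp only [step, newBase]
    split_ifs with hind
    · rw [I.oracles_indep] at hind
      refine ⟨hind, fun a ha => ?_⟩
      rw [List.mem_append] at ha
      rcases ha with ha | ha
      · exact (I.M i₀).closure_subset_closure (by simp) (h2 a ha)
      · rw [List.mem_singleton] at ha
        subst ha
        exact (I.M i₀).mem_closure_of_mem (by simp) hind.subset_ground
    · rw [I.oracles_indep] at hind
      refine ⟨h1, fun a ha => ?_⟩
      rw [List.mem_append] at ha
      rcases ha with ha | ha
      · exact h2 a ha
      · rw [List.mem_singleton] at ha
        subst ha
        by_contra hcl
        refine hind ?_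
        rw [Finset.coe_insert]
        by_cases hm : a ∈ (s.base : Set α)
        · rwa [Set.insert_eq_of_mem hm]
        · exact (h1.insert_indep_iff_of_notMem hm).2 ⟨huE, hcl⟩

/-- The properties of the stored most valuable element. -/
theorem best_stateAfter (ε : ℝ) (ℓ : ℕ → ℕ) (i₀ : Fin k) (I : SMkMInstance α k) (l : List α) :
    (∀ b ∈ (stateAfter ε ℓ i₀ I.oracles l).best, I.CommonIndep {b}) ∧
    I.f ∅ ≤ I.f (stateAfter ε ℓ i₀ I.oracles l).best.toFinset ∧
    ∀ a ∈ l, I.CommonIndep {a} → I.f {a} ≤ I.f (stateAfter ε ℓ i₀ I.oracles l).best.toFinset := by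
  induction l using List.reverseRecOn with
  | nil => simp [stateAfter, initial]
  | append_singleton l u ih =>
    obtain ⟨h1, h2, h3⟩ := ih
    rw [stateAfter_append]
    set s := stateAfter ε ℓ i₀ I.oracles l
    have hc : (∀ i, I.oracles.indep i {u} = true) ↔ I.CommonIndep {u} :=
      forall_congr' fun i => I.oracles_indep
    simp only [step, newBest]
    split_ifs with hu
    · have hlt : I.f s.best.toFinset < I.f {u} := hu.2
      refine ⟨?_, ?_, ?_⟩
      · rintro b hb
        cases hb
        exact hc.1 hu.1
      · simpa using h2.trans hlt.le
      · intro a ha hfa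
        rcases List.mem_append.1 ha with ha | ha
        · simpa using (h3 a ha hfa).trans hlt.le
        · rw [List.mem_singleton.1 ha]; simp
    · refine ⟨h1, h2, fun a ha hfa => ?_⟩
      rcases List.mem_append.1 ha with ha | ha
      · exact h3 a ha hfa
      · rw [List.mem_singleton.1 ha] at hfa ⊢
        exact not_lt.1 fun h => hu ⟨hc.2 hfa, h⟩

/-- The threshold in force after the elements of `l` have arrived. -/
noncomputable def thresholdAfter (ε : ℝ) (ℓ : ℕ → ℕ) (i₀ : Fin k) (O : Oracles α k)
    (l : List α) : ℝ :=
  threshold ε O (stateAfter ε ℓ i₀ O l).base (stateAfter ε ℓ i₀ O l).best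

theorem threshold_lt (ε : ℝ) (ℓ : ℕ → ℕ) (i₀ : Fin k) (O : Oracles α k) (l : List α)
    {w : SearchWord α k} (hw : w ∈ (stateAfter ε ℓ i₀ O l).words) :
    thresholdAfter ε ℓ i₀ O l < Real.exp (ε * key ε O w) := by
  induction l using List.reverseRecOn with
  | nil => simp [stateAfter, initial] at hw
  | append_singleton l u ih =>
    rw [thresholdAfter]
    rw [stateAfter_append] at hw ⊢
    exact (mem_prune.1 hw).2 w (mem_prune.1 hw).1 List.suffix_rfl

/-- The stored basis spans everything seen in matroid `i₀`. Its size thus serves as a substitute for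
the unknown rank in the threshold. -/
theorem card_le_card_base (ε : ℝ) (ℓ : ℕ → ℕ) (i₀ : Fin k) (I : SMkMInstance α k)
    {l : List α} (hl : l <+: I.stream) {T : Finset α} (hT : I.CommonIndep T)
    (h : ∀ a ∈ T, a ∈ l) : T.card ≤ (stateAfter ε ℓ i₀ I.oracles l).base.card := by
  obtain ⟨h1, h2⟩ := base_stateAfter ε ℓ i₀ I hl
  have := (hT i₀).encard_le_eRk_of_subset (X := (I.M i₀).closure
    ((stateAfter ε ℓ i₀ I.oracles l).base : Set α)) fun a ha => h2 a (h a ha)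
  rw [Matroid.eRk_closure_eq, h1.eRk_eq_encard, Set.encard_coe_eq_coe_finsetCard,
    Set.encard_coe_eq_coe_finsetCard] at this
  exact_mod_cast this

end SearchState

/-! ### Submodularity and harmless elements. -/

namespace SMkMInstance

variable {α : Type*} [DecidableEq α] {k : ℕ} (I : SMkMInstance α k)

/-- Non-negativity of the smaller set's gain covers the case `a ∈ Z`, where the gain over `Z` is
zero. -/
theorem marginal_le_of_subset {S Z : Finset α} (hSZ : S ⊆ Z) (hZ : Z ⊆ I.stream.toFinset) {a : α}
    (ha : a ∈ I.stream.toFinset) (hg : 0 ≤ I.f (insert a S) - I.f S) :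
    I.f (insert a Z) - I.f Z ≤ I.f (insert a S) - I.f S := by
  by_cases h : a ∈ Z
  · rwa [Finset.insert_eq_of_mem h, sub_self]
  · exact I.submodular S Z hSZ hZ a (by simp only [Finset.mem_sdiff]; exact ⟨ha, h⟩)

/-- There is an optimal solution. -/
theorem exists_optimal (i₀ : Fin k) :
    ∃ T, I.CommonIndep T ∧ ∀ S, I.CommonIndep S → I.f S ≤ I.f T := by
  classical
  obtain ⟨T, hT, hmax⟩ := Finset.exists_max_image
    (I.stream.toFinset.powerset.filter fun S => I.CommonIndep S) I.f
    ⟨∅, Finset.mem_filter.2 ⟨by simp, fun i => by simp⟩⟩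
  exact ⟨T, (Finset.mem_filter.1 hT).2, fun S hS => hmax S
    (Finset.mem_filter.2 ⟨Finset.mem_powerset.2 (I.subset_of_indep (hS i₀)), hS⟩)⟩

/-- The gain of a set is at most the sum of the gains of its elements. -/
theorem le_sum_insert {Z X : Finset α} (hZ : Z ⊆ I.stream.toFinset)
    (hX : X ⊆ I.stream.toFinset) :
    I.f (Z ∪ X) - I.f Z ≤ ∑ a ∈ X, (I.f (insert a Z) - I.f Z) := by
  induction X using Finset.induction_on with
  | empty => simp
  | insert a X ha ih =>
    rw [Finset.sum_insert ha]
    have ih := ih fun b hb => hX (by simp [hb])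
    have haX : a ∈ I.stream.toFinset := hX (by simp)
    by_cases haZ : a ∈ Z
    · rw [show Z ∪ insert a X = Z ∪ X by ext; aesop, Finset.insert_eq_of_mem haZ]
      linarith
    · rw [Finset.union_insert]
      have := I.submodular Z (Z ∪ X) Finset.subset_union_left
        (Finset.union_subset hZ fun b hb => hX (by simp [hb])) a
        (by simp only [Finset.mem_sdiff, Finset.mem_union]; exact ⟨haX, by tauto⟩)
      linarith

/-- Among `ℓ j` elements, there is one whose addition to a set decreases its value by at most
a factor of `1 - ε / 2 ^ (j + 1)`. -/
def HasHarmless (ε : ℝ) (ℓ : ℕ → ℕ) : Prop :=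
  ∀ j, ∀ Z ⊆ I.stream.toFinset, ∀ x : Fin (ℓ j) → α, Function.Injective x →
    (∀ c, x c ∈ I.stream.toFinset) →
    ∃ c, (1 - ε / 2 ^ (j + 1)) * I.f Z ≤ I.f (insert (x c) Z)

theorem hasHarmless_of_isMonotone {ε : ℝ} (hε : 0 < ε) (h : I.IsMonotone) :
    I.HasHarmless ε fun _ => 1 := by
  intro j Z hZ x _ hx
  refine ⟨0, ?_⟩
  have h1 := h Z (insert (x 0) Z) (Finset.subset_insert _ _) (Finset.insert_subset (hx 0) hZ)
  have h2 := mul_nonneg (by positivity : 0 ≤ ε / 2 ^ (j + 1)) (I.nonneg Z hZ)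
  linarith

/-- If each of `n ≥ 2 ^ (j + 1) / ε` distinct elements lost more than the fraction `ε / 2 ^ (j + 1)`
of `f Z`, then by submodularity adding all of them would lose more than `f Z`, making `f` negative.
-/
theorem hasHarmless_ceil {ε : ℝ} (hε : 0 < ε) :
    I.HasHarmless ε fun j => ⌈2 ^ (j + 1) / ε⌉₊ := by
  intro j Z hZ x hx hxs
  by_contra! hcon
  have hpos : 0 < (2 : ℝ) ^ (j + 1) / ε := by positivity
  have hn : (2 : ℝ) ^ (j + 1) / ε ≤ (⌈(2 : ℝ) ^ (j + 1) / ε⌉₊ : ℝ) := Nat.le_ceil _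
  set n := ⌈(2 : ℝ) ^ (j + 1) / ε⌉₊
  have hn0 : 0 < n := Nat.ceil_pos.2 hpos
  have hX : Finset.univ.image x ⊆ I.stream.toFinset := by
    intro a ha
    obtain ⟨c, -, rfl⟩ := Finset.mem_image.1 ha
    exact hxs c
  have h1 := I.le_sum_insert hZ hX
  rw [Finset.sum_image fun a _ b _ h => hx h] at h1
  have h2 : ∑ c, (I.f (insert (x c) Z) - I.f Z) < ∑ c : Fin n, -(ε / 2 ^ (j + 1) * I.f Z) :=
    Finset.sum_lt_sum_of_nonempty ⟨⟨0, hn0⟩, Finset.mem_univ _⟩ fun c _ => by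
      have := hcon c
      linarith
  rw [Finset.sum_const, Finset.card_univ, Fintype.card_fin, nsmul_eq_mul] at h2
  have h3 := I.nonneg _ (Finset.union_subset hZ hX)
  have h4 := I.nonneg Z hZ
  have h5 : 1 ≤ (n : ℝ) * (ε / 2 ^ (j + 1)) := by
    rw [div_le_iff₀ hε] at hn
    rw [← mul_div_assoc, le_div_iff₀ (by positivity)]
    linarith
  have h6 := mul_le_mul_of_nonneg_right h5 h4
  linarith

end SMkMInstance

/-! ### Rounding of gains on the logarithmic scale. -/

theorem mul_le_of_floor_log_eq {ε v w : ℝ} (hε : 0 < ε) (hv : 0 < v) (hw : 0 < w)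
    (h : ⌊Real.log w / ε⌋ = ⌊Real.log v / ε⌋) : (1 - ε) * v ≤ w := by
  have h1 : Real.log v / ε < Real.log w / ε + 1 := by
    have h2 := Int.lt_floor_add_one (Real.log v / ε)
    have h3 := Int.floor_le (Real.log w / ε)
    rw [h] at h3
    linarith
  have h2 : Real.log v - ε < Real.log w := by
    rw [div_add_one hε.ne', div_lt_div_iff_of_pos_right hε] at h1
    linarith
  have h3 := Real.exp_lt_exp.2 h2
  rw [Real.exp_log hw, sub_eq_add_neg, Real.exp_add, Real.exp_log hv] at h3
  have h4 : 1 - ε ≤ Real.exp (-ε) := by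
    have := Real.add_one_le_exp (-ε)
    linarith
  nlinarith

theorem lt_two_mul_exp_floor_log {ε v : ℝ} (hε : 0 < ε) (hε' : ε < 1 / 7) (hv : 0 < v) :
    v < 2 * Real.exp (ε * ⌊Real.log v / ε⌋) := by
  have h1 := Int.lt_floor_add_one (Real.log v / ε)
  rw [div_lt_iff₀ hε] at h1
  have h2 := Real.exp_lt_exp.2 h1
  rw [Real.exp_log hv, add_mul, one_mul, Real.exp_add, mul_comm _ ε] at h2
  have h3 : Real.exp ε ≤ 2 := by
    have : ε ≤ Real.log 2 := by linarith [Real.log_two_gt_d9]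
    simpa [Real.exp_log] using Real.exp_le_exp.2 this
  have h4 := Real.exp_pos (ε * ⌊Real.log v / ε⌋)
  nlinarith

/-! ### The search for a replacement and the approximation guarantee. -/

namespace SearchState

open SearchWord

variable {α : Type*} [DecidableEq α] {k : ℕ} {ε : ℝ} {ℓ : ℕ → ℕ} {i₀ : Fin k}
  {I : SMkMInstance α k} {l : List α} {u : α} {W : Finset (SearchWord α k)}

theorem weight_cons (b : ℕ ⊕ Fin k) (a : α) (q : SearchWord α k) :
    weight I.oracles ((b, a) :: q) =
      I.f (insert a (before ((b, a) :: q))) - I.f (before ((b, a) :: q)) := by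
  rw [weight, taken_cons]; rfl

/-- Along the branches of a search that lead to elements spanned by `R`, there is an element
that extends `R`, or a place for a new element that extends `R`. -/
theorem IsSearchTree.exists_mem_or_candidate (h : IsSearchTree ε ℓ I l W)
    {p : SearchWord α k} (hp : p = [] ∨ p ∈ W) {c : ℕ} (hc : c < ℓ (taken p).card)
    {R : Finset α} (hpR : taken p ⊆ R) (huR : u ∉ R) (hR : I.CommonIndep (insert u R))
    (hv : 0 < I.f (insert u (taken p)) - I.f (taken p)) :
    (∃ b a q, (b, a) :: q ∈ W ∧ root ((b, a) :: q) = p ∧ copy ((b, a) :: q) = c ∧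
      key ε I.oracles ((b, a) :: q) = ⌊Real.log (I.f (insert u (taken p)) - I.f (taken p)) / ε⌋ ∧
      before ((b, a) :: q) = taken p ∧ I.CommonIndep (insert a R)) ∨
    ∃ b q, (b, u) :: q ∈ candidates ε ℓ I.oracles W u ∧ root ((b, u) :: q) = p ∧
      copy ((b, u) :: q) = c ∧ before ((b, u) :: q) = taken p := by
  set K := ⌊Real.log (I.f (insert u (taken p)) - I.f (taken p)) / ε⌋ with hK
  have hRi : ∀ i, (I.M i).Indep (R : Set α) := fun i => (hR i).subset (by simp)
  have hucl : ∀ i, u ∉ (I.M i).closure (R : Set α) := fun i => by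
    have := hR i
    rw [Finset.coe_insert, (hRi i).insert_indep_iff_of_notMem (by simpa using huR)] at this
    exact this.2
  have huE : ∀ i, u ∈ (I.M i).E := fun i => (hR i).subset_ground (by simp)
  -- The search descends from the place `(b, q)`, keeping every record inside the closure of `R`. It
  -- ends because no stored branch is longer than the longest one.
  suffices H : ∀ n, ∀ b q, W.sup List.length - q.length ≤ n → (q = [] ∨ q ∈ W) →
      (∀ c, b = .inl c → c < ℓ (taken q).card) → root ((b, u) :: q) = p →
      copy ((b, u) :: q) = c → before ((b, u) :: q) = taken p →
      (∀ i, (spans ((b, u) :: q) i : Set α) ⊆ (I.M i).closure (R : Set α)) →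
      (∀ i, b = .inr i → q ≠ [] ∧ key ε I.oracles q = K) →
      (∃ b a q, (b, a) :: q ∈ W ∧ root ((b, a) :: q) = p ∧ copy ((b, a) :: q) = c ∧
        key ε I.oracles ((b, a) :: q) = K ∧
        before ((b, a) :: q) = taken p ∧ I.CommonIndep (insert a R)) ∨
      ∃ b q, (b, u) :: q ∈ candidates ε ℓ I.oracles W u ∧ root ((b, u) :: q) = p ∧
        copy ((b, u) :: q) = c ∧ before ((b, u) :: q) = taken p by
    refine H _ (.inl c) p le_rfl hp ?_ rfl rfl rfl ?_ (by simp)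
    · rintro _ ⟨⟩; exact hc
    · intro i
      exact (Finset.coe_subset.2 hpR).trans ((I.M i).subset_closure _ (hRi i).subset_ground)
  intro n
  induction n with
  | zero => ?_
  | succ n ih => ?_
  all_goals
    intro b q hn hq hb hroot hcopy hbef hspan hkq
    have hkx : key ε I.oracles ((b, u) :: q) = K := by
      rw [key, weight_cons, hbef]
    by_cases hocc : ∃ y ∈ W, y.tail = q ∧ label y = some b ∧ key ε I.oracles y = K
  case neg | neg =>
    right
    refine ⟨b, q, mem_candidates.2 ⟨mem_extensions.2 ⟨q, hq, b, hb, rfl⟩, ?_, ?_, ?_, ?_⟩,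
      hroot, hcopy, hbef⟩
    · rw [weight_cons, hbef]; exact hv
    · intro i
      rw [I.oracles_indep, last_cons, ← Finset.insert_eq, Finset.coe_insert]
      have hA : (I.M i).Indep (spans ((b, u) :: q) i : Set α) := by
        rcases b with c' | j
        · exact (hRi i).subset (by
            rw [spans_inl]
            exact Finset.coe_subset.2 (by rwa [← before_inl c' u, hbef]))
        · refine (h.indep q (hq.resolve_left (hkq j rfl).1) i).subset (Finset.coe_subset.2 ?_)
          rw [spans_inr]
          split_ifs
          · rw [Finset.union_comm]
          · exact Finset.subset_union_right
      have hucl' : u ∉ (I.M i).closure (spans ((b, u) :: q) i : Set α) := fun hu =>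
        hucl i ((I.M i).closure_subset_closure_of_subset_closure (hspan i) hu)
      rw [hA.insert_indep_iff]
      exact .inl ⟨huE i, hucl'⟩
    · intro y hy ht hl hk
      exact hocc ⟨y, hy, ht, hl, hk.trans hkx⟩
    · intro i hi
      have := hkq i (by simpa using hi)
      exact ⟨this.1, hkx.trans this.2.symm⟩
  all_goals
    obtain ⟨y, hy, rfl, hlab, hyk⟩ := hocc
    have hlen : y.length ≤ W.sup List.length := Finset.le_sup (f := List.length) hy
    rcases y with _ | ⟨⟨b', a⟩, q⟩
    · exact absurd hy h.nil_notMem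
    simp only [label_cons, Option.some.injEq] at hlab
    subst hlab
    simp only [List.tail_cons, List.length_cons] at *
  · omega
  · have hbefa : before ((b', a) :: q) = taken p := by rw [← hbef]; exact before_congr ..
    by_cases hcom : I.CommonIndep (insert a R)
    · left
      refine ⟨b', a, q, hy, ?_, ?_, hyk, hbefa, hcom⟩
      · rw [← hroot]; cases b' <;> rfl
      · rw [← hcopy]; cases b' <;> rfl
    -- The occupant is rejected by some matroid `i`; there it lies in the closure of `R`, so
    -- recording it under label `inr i` preserves the invariant.
    · have ⟨i, hi⟩ : ∃ i, ¬ (I.M i).Indep ((insert a R : Finset α) : Set α) := by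
        by_contra! hcon; exact hcom hcon
      have haE : a ∈ (I.M i).E := (h.indep _ hy i).subset_ground (by simp)
      have hacl : a ∈ (I.M i).closure (R : Set α) := by
        by_contra hcon
        refine hi ?_
        rw [Finset.coe_insert, (hRi i).insert_indep_iff]
        exact .inl ⟨haE, hcon⟩
      refine ih (.inr i) ((b', a) :: q) (by simp only [List.length_cons]; omega) (.inr hy) (by simp)
        ?_ ?_ ?_ ?_ ?_
      · rw [root_inr, ← hroot]; cases b' <;> rfl
      · rw [copy_inr, ← hcopy]; cases b' <;> rfl
      · rw [before_inr, hbefa]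
      · intro j
        rw [spans_inr, spans_congr b' a u]
        split_ifs with hji
        · subst hji
          rw [Finset.coe_union, last_cons, Finset.coe_singleton]
          exact Set.union_subset (hspan j) (by simpa using hacl)
        · exact hspan j
      · rintro _ -
        exact ⟨by simp, hyk⟩

/-- Keys are constant within a search. Survival of a branch therefore reduces to survival of its
root and of a single key. -/
theorem IsSearchTree.suffix_root_or_key_eq (h : IsSearchTree ε ℓ I l W) {x y : SearchWord α k}
    (hx : x ∈ W) (hyx : y <:+ x) : y <:+ root x ∨ key ε I.oracles y = key ε I.oracles x := by
  induction x with
  | nil => exact absurd hx h.nil_notMem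
  | cons z q ih =>
    rcases List.suffix_cons_iff.1 hyx with rfl | hyq
    · exact .inr rfl
    · obtain ⟨c | i, a⟩ := z
      · exact .inl hyq
      · obtain ⟨h1, h2⟩ := h.key_eq i a q hx
        rw [root_inr, h2]
        exact ih ((h.tail_mem _ _ hx).resolve_left h1) hyq

theorem IsSearchTree.before_eq_taken_root (h : IsSearchTree ε ℓ I l W) {x : SearchWord α k}
    (hx : x ∈ W) : before x = taken (root x) := by
  induction x with
  | nil => exact absurd hx h.nil_notMem
  | cons z q ih =>
    obtain ⟨c | i, a⟩ := z
    · rfl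
    · exact ih ((h.tail_mem _ _ hx).resolve_left (h.key_eq i a q hx).1)

/-- A partial solution of the search tree that can be completed to a good solution by the
elements of `T` that are yet to arrive. -/
structure IsProgress (ε : ℝ) (ℓ : ℕ → ℕ) (i₀ : Fin k) (I : SMkMInstance α k) (T : Finset α)
    (l : List α) (p : SearchWord α k) : Prop where
  mem : p = [] ∨ p ∈ (stateAfter ε ℓ i₀ I.oracles l).words
  -- All future thresholds are required, since the threshold is not monotone in time: it rises with
  -- the best element and falls as the basis grows.
  alive : ∀ l', l <+: l' → l' <+: I.stream → ∀ y, y <:+ p → y ≠ [] →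
    thresholdAfter ε ℓ i₀ I.oracles l' < Real.exp (ε * key ε I.oracles y)
  indep : I.CommonIndep (taken p ∪ T.filter (· ∉ l))
  -- Taking the `(j + 1)`-st element may cost the fraction `ε / 2 ^ (j + 1)`; these fractions add up
  -- to at most `ε`.
  harmless : (1 - ε * (1 - (1 / 2) ^ (taken p).card)) * I.f T ≤ I.f (taken p ∪ T)
  -- The last summand is the budget for skipped elements: the partial sum of `1 / (n (n + 1))`,
  -- times `2 * ε * f T`.
  gain : (1 - ε) * (I.f (taken p ∪ T.filter (· ∈ l)) - I.f (taken p)) ≤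
    I.f (taken p) - I.f ∅ + 2 * ε * I.f T * (1 - 1 / ((T.filter (· ∈ l)).card + 1))

theorem filter_mem_append {T : Finset α} (huT : u ∈ T) :
    T.filter (· ∈ l ++ [u]) = insert u (T.filter (· ∈ l)) := by
  ext a
  simp only [Finset.mem_filter, List.mem_append, List.mem_singleton, Finset.mem_insert]
  constructor
  · rintro ⟨h1, h2 | h2⟩ <;> simp [h1, h2]
  · rintro (rfl | h) <;> simp [*]

theorem insert_filter_notMem_append {T : Finset α} (huT : u ∈ T) (hu : u ∉ l) :
    insert u (T.filter (· ∉ l ++ [u])) = T.filter (· ∉ l) := by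
  ext a
  simp only [Finset.mem_filter, List.mem_append, List.mem_singleton, Finset.mem_insert]
  by_cases e : a = u
  · subst e; simp [huT, hu]
  · simp [e]

theorem one_sub_inv_add (F : ℝ) (n : ℕ) :
    F * (1 - 1 / ((n : ℝ) + 1)) + F / (((n : ℝ) + 1) * ((n + 1 : ℝ) + 1)) =
      F * (1 - 1 / ((n + 1 : ℝ) + 1)) := by
  field_simp
  ring

/-- An element that extends the rest of `T` in the same way as the arriving element of `T`, and is
not given up later, can be taken instead of it. -/
theorem IsProgress.take (hε : 0 < ε) (hε' : ε < 1 / 7) {T : Finset α} (hT : I.CommonIndep T)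
    (hl : l ++ [u] <+: I.stream) (huT : u ∈ T) {p : SearchWord α k}
    (hp : IsProgress ε ℓ i₀ I T l p)
    (hv : 0 < I.f (insert u (taken p)) - I.f (taken p))
    (halive : ∀ l', l ++ [u] <+: l' → l' <+: I.stream → thresholdAfter ε ℓ i₀ I.oracles l' <
      Real.exp (ε * ⌊Real.log (I.f (insert u (taken p)) - I.f (taken p)) / ε⌋))
    {b : ℕ ⊕ Fin k} {a : α} {q : SearchWord α k}
    (hx : (b, a) :: q ∈ grown ε ℓ I.oracles (stateAfter ε ℓ i₀ I.oracles l).words u)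
    (hroot : root ((b, a) :: q) = p)
    (hkey : key ε I.oracles ((b, a) :: q) =
      ⌊Real.log (I.f (insert u (taken p)) - I.f (taken p)) / ε⌋)
    (hbef : before ((b, a) :: q) = taken p)
    (hind : I.CommonIndep (insert a (taken p ∪ T.filter (· ∉ l ++ [u]))))
    (hdrop : (1 - ε / 2 ^ ((taken p).card + 1)) * I.f (taken p ∪ T) ≤
      I.f (insert a (taken p ∪ T))) :
    IsProgress ε ℓ i₀ I T (l ++ [u]) ((b, a) :: q) := by
  have hul := I.notMem_of_prefix hl
  have htree := (isSearchTree_stateAfter ε ℓ i₀ I ((List.prefix_append l [u]).trans hl)).grown hul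
  have htaken : taken ((b, a) :: q) = insert a (taken p) := by rw [taken_cons, hbef]
  have hTs := I.subset_of_indep (hT i₀)
  have hps : taken p ⊆ I.stream.toFinset :=
    Finset.subset_union_left.trans (I.subset_of_indep (hp.indep i₀))
  have has : a ∈ I.stream.toFinset := I.subset_of_indep (hind i₀) (by simp)
  have haS : a ∉ taken p := fun ha => htree.notMem_spans _ _ hx i₀
    (before_subset_spans _ _ (by rwa [hbef]))
  have hfT : 0 ≤ I.f T := I.nonneg T hTs
  have halive' : ∀ l', l ++ [u] <+: l' → l' <+: I.stream → ∀ y, y <:+ (b, a) :: q → y ≠ [] →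
      thresholdAfter ε ℓ i₀ I.oracles l' < Real.exp (ε * key ε I.oracles y) := by
    intro l' h1 h2 y hy hne
    rcases htree.suffix_root_or_key_eq hx hy with hy | hy
    · rw [hroot] at hy
      exact hp.alive l' ((List.prefix_append l [u]).trans h1) h2 y hy hne
    · rw [hy, hkey]
      exact halive l' h1 h2
  have hwpos := htree.weight_pos _ hx
  have hmul := mul_le_of_floor_log_eq hε hv hwpos hkey
  rw [weight_cons, hbef] at hwpos hmul
  refine ⟨.inr ?_, halive', ?_, ?_, ?_⟩
  · rw [stateAfter_append]
    refine mem_prune.2 ⟨hx, fun y hy hyx => ?_⟩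
    have := halive' _ List.prefix_rfl hl y hyx (by rintro rfl; exact htree.nil_notMem hy)
    rwa [thresholdAfter, stateAfter_append] at this
  · rwa [htaken, Finset.insert_union]
  · rw [htaken, Finset.insert_union, Finset.card_insert_of_notMem haS]
    refine le_trans ?_ hdrop
    have hn : 0 ≤ 1 - ε / 2 ^ ((taken p).card + 1) := by
      have : ε / 2 ^ ((taken p).card + 1) ≤ ε := div_le_self hε.le (one_le_pow₀ (by norm_num))
      linarith
    refine le_trans ?_ (mul_le_mul_of_nonneg_left hp.harmless hn)
    rw [← mul_assoc]
    refine mul_le_mul_of_nonneg_right ?_ hfT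
    have e : ε / 2 ^ ((taken p).card + 1) = ε * (1 / 2) ^ (taken p).card / 2 := by
      rw [pow_succ, one_div, inv_pow]; field_simp
    rw [e, pow_succ]
    have h1 : (0 : ℝ) < (1 / 2) ^ (taken p).card := by positivity
    have h2 : ((1 : ℝ) / 2) ^ (taken p).card ≤ 1 := pow_le_one₀ (by norm_num) (by norm_num)
    generalize ((1 : ℝ) / 2) ^ (taken p).card = z at h1 h2
    have : 0 ≤ ε * ε * (z * (1 - z)) := by
      have := sub_nonneg.2 h2
      positivity
    nlinarith
  · rw [htaken, filter_mem_append huT, Finset.card_insert_of_notMem (by simp [hul])]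
    have hZ : ∀ Z ⊆ T, taken p ∪ Z ⊆ I.stream.toFinset := fun Z hZ =>
      Finset.union_subset hps (hZ.trans hTs)
    have hTl : T.filter (· ∈ l) ⊆ T := Finset.filter_subset _ _
    -- With `w` and `v` the gains of `a` and `u` over `taken p`, adding both to the union raises its
    -- value by at most `w + v`, while the value of the solution rises by exactly `w`. The
    -- difference grows by at most `v`, and `(1 - ε) * v ≤ w` pays for it.
    have h1 := I.marginal_le_of_subset (Finset.subset_union_left (s₂ := T.filter (· ∈ l)))
      (hZ _ hTl) has hwpos.le
    have h2 := I.marginal_le_of_subset (S := taken p)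
      (Z := insert a (taken p ∪ T.filter (· ∈ l)))
      (Finset.subset_union_left.trans (Finset.subset_insert _ _))
      (Finset.insert_subset has (hZ _ hTl)) (hTs huT) hv.le
    rw [Finset.insert_union, Finset.union_insert, Finset.insert_comm]
    have h3 := hp.gain
    have h4 := one_sub_inv_add (2 * ε * I.f T) (T.filter (· ∈ l)).card
    have h5 : 0 ≤ 2 * ε * I.f T / ((((T.filter (· ∈ l)).card : ℝ) + 1) *
      (((T.filter (· ∈ l)).card + 1 : ℝ) + 1)) := by positivity
    push_cast
    have h6 : 0 < 1 - ε := by linarith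
    nlinarith

/-- The best stored value is that of a feasible set, hence at most `f T`, and the basis is at least
as large as any feasible set already seen. -/
theorem thresholdAfter_le (hε : 0 < ε) {T : Finset α}
    (hmax : ∀ S, I.CommonIndep S → I.f S ≤ I.f T) (hl : l <+: I.stream) {X : Finset α}
    (hX : I.CommonIndep X) (hXl : ∀ a ∈ X, a ∈ l) (hpos : 0 < X.card) :
    thresholdAfter ε ℓ i₀ I.oracles l ≤ ε * I.f T / (X.card * (X.card + 1)) := by
  obtain ⟨h1, h2, -⟩ := best_stateAfter ε ℓ i₀ I l
  have hcard := card_le_card_base ε ℓ i₀ I hl hX hXl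
  rw [thresholdAfter, threshold]
  set s := stateAfter ε ℓ i₀ I.oracles l
  have h0 : 0 ≤ I.f ∅ := I.nonneg ∅ (by simp)
  have hempty : I.CommonIndep ∅ := fun i => by simp
  have h3 : I.f s.best.toFinset ≤ I.f T := by
    rcases hb : s.best with _ | b
    · simpa using hmax ∅ hempty
    · simpa using hmax {b} (h1 b hb)
  have h4 : I.oracles.value s.best.toFinset - I.oracles.value ∅ ≤ I.f T := by
    change I.f _ - I.f _ ≤ _; linarith
  have h5 : 0 ≤ I.f T := h0.trans (hmax ∅ hempty)
  have h6 : (X.card : ℝ) ≤ s.base.card := by exact_mod_cast hcard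
  have h7 : (0 : ℝ) < X.card := by exact_mod_cast hpos
  gcongr

/-- If an arriving element of `T` brings little, it is skipped. -/
theorem IsProgress.skip (hε : 0 < ε) (hε' : ε < 1 / 7) {T : Finset α} (hT : I.CommonIndep T)
    (hmax : ∀ S, I.CommonIndep S → I.f S ≤ I.f T)
    (hl : l ++ [u] <+: I.stream) (huT : u ∈ T) {p : SearchWord α k}
    (hp : IsProgress ε ℓ i₀ I T l p)
    (hv : ¬ (0 < I.f (insert u (taken p)) - I.f (taken p) ∧
      ∀ l', l ++ [u] <+: l' → l' <+: I.stream → thresholdAfter ε ℓ i₀ I.oracles l' <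
        Real.exp (ε * ⌊Real.log (I.f (insert u (taken p)) - I.f (taken p)) / ε⌋)))
    (hmem : p = [] ∨ p ∈ (stateAfter ε ℓ i₀ I.oracles (l ++ [u])).words) :
    IsProgress ε ℓ i₀ I T (l ++ [u]) p := by
  have hul := I.notMem_of_prefix hl
  have hTs := I.subset_of_indep (hT i₀)
  have hins := insert_filter_notMem_append huT hul
  have hps : taken p ∪ T.filter (· ∈ l) ⊆ I.stream.toFinset :=
    Finset.union_subset (Finset.subset_union_left.trans (I.subset_of_indep (hp.indep i₀)))
      ((Finset.filter_subset _ _).trans hTs)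
  have hup : u ∉ taken p := by
    intro hu
    obtain ⟨x, hx, rfl⟩ := mem_of_mem_taken hu
    rcases hp.mem with rfl | hm
    · simp at hx
    · exact hul ((isSearchTree_stateAfter ε ℓ i₀ I
        ((List.prefix_append l [_]).trans hl)).mem p hm x hx)
  have hfT : 0 ≤ I.f T := I.nonneg T hTs
  refine ⟨hmem, fun l' h1 h2 => hp.alive l' ((List.prefix_append l [u]).trans h1) h2, ?_,
    hp.harmless, ?_⟩
  · refine SMkMInstance.CommonIndep.subset I hp.indep (Finset.union_subset_union_right ?_)
    rw [← hins]; exact Finset.subset_insert _ _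
  · set F := T.filter (· ∈ l)
    set v := I.f (insert u (taken p)) - I.f (taken p) with hvdef
    have huF : u ∉ F := by simp [F, hul]
    have hcard : (insert u F).card = F.card + 1 := Finset.card_insert_of_notMem huF
    -- If `v` is positive, its key falls to some later threshold. At that time the `F.card + 1`
    -- elements `insert u F` of `T` have all arrived, which bounds this threshold; the factor 2
    -- accounts for rounding.
    have hle : v ≤ 2 * ε * I.f T / (((F.card : ℝ) + 1) * ((F.card + 1 : ℝ) + 1)) := by
      by_cases hv0 : 0 < v
      · simp only [hv0, true_and, not_forall, not_lt] at hv
        obtain ⟨l', h1, h2, h3⟩ := hv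
        have h4 := lt_two_mul_exp_floor_log hε hε' hv0
        have h5 := thresholdAfter_le (ℓ := ℓ) (i₀ := i₀) hε hmax h2 (X := insert u F)
          (hT.subset I (by
            rw [← filter_mem_append huT]; exact Finset.filter_subset _ _))
          (fun a ha => by
            rw [← filter_mem_append huT] at ha
            exact h1.subset (Finset.mem_filter.1 ha).2) (by omega)
        rw [hcard] at h5
        push_cast at h5
        calc v ≤ 2 * (ε * I.f T / (((F.card : ℝ) + 1) * ((F.card + 1 : ℝ) + 1))) := by linarith
          _ = _ := by ring
      · exact (not_lt.1 hv0).trans (by positivity)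
    have h1 := I.submodular (taken p) (taken p ∪ F) Finset.subset_union_left hps u (by
      simp only [Finset.mem_sdiff, Finset.mem_union]
      exact ⟨hTs huT, by tauto⟩)
    rw [filter_mem_append huT, hcard, Finset.union_insert]
    have h3 := hp.gain
    have h4 := one_sub_inv_add (2 * ε * I.f T) F.card
    have h5 : 0 ≤ 2 * ε * I.f T / (((F.card : ℝ) + 1) * ((F.card + 1 : ℝ) + 1)) := by positivity
    push_cast
    have h6 : 0 < 1 - ε := by linarith
    nlinarith

theorem exists_isProgress (hε : 0 < ε) (hε' : ε < 1 / 7) (hℓ : I.HasHarmless ε ℓ) {T : Finset α}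
    (hT : I.CommonIndep T) (hmax : ∀ S, I.CommonIndep S → I.f S ≤ I.f T) (hl : l <+: I.stream) :
    ∃ p, IsProgress ε ℓ i₀ I T l p := by
  have hTs := I.subset_of_indep (hT i₀)
  induction l using List.reverseRecOn with
  | nil =>
    refine ⟨[], .inl rfl, ?_, ?_, ?_, ?_⟩
    · intro l' _ _ y hy hne
      exact absurd (List.suffix_nil.1 hy) hne
    · simpa using hT
    · simp
    · simp
  | append_singleton l u ih =>
    have hl' := (List.prefix_append l [u]).trans hl
    obtain ⟨p, hp⟩ := ih hl'
    have hul := I.notMem_of_prefix hl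
    have htree := isSearchTree_stateAfter ε ℓ i₀ I hl'
    have hmem : p = [] ∨ p ∈ (stateAfter ε ℓ i₀ I.oracles (l ++ [u])).words := by
      refine hp.mem.imp_right fun hm => ?_
      rw [stateAfter_append]
      refine mem_prune.2 ⟨mem_grown.2 (.inl hm), fun y hy hyp => ?_⟩
      have := hp.alive (l ++ [u]) (List.prefix_append l [u]) hl y hyp
        (by rintro rfl; exact (htree.grown hul).nil_notMem hy)
      rwa [thresholdAfter, stateAfter_append] at this
    by_cases huT : u ∈ T
    swap
    · have h1 : T.filter (· ∈ l ++ [u]) = T.filter (· ∈ l) := by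
        refine Finset.filter_congr fun a ha => ?_
        have : a ≠ u := fun e => huT (e ▸ ha)
        simp [this]
      have h2 : T.filter (· ∉ l ++ [u]) = T.filter (· ∉ l) := by
        refine Finset.filter_congr fun a ha => ?_
        have : a ≠ u := fun e => huT (e ▸ ha)
        simp [this]
      exact ⟨p, hmem, fun l' h1 h2 => hp.alive l' ((List.prefix_append l [u]).trans h1) h2,
        by rw [h2]; exact hp.indep, hp.harmless, by rw [h1]; exact hp.gain⟩
    -- Whether `u` is worth taking is decided with knowledge of all future thresholds; this is
    -- legitimate as only the analysis makes this choice.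
    by_cases hv : 0 < I.f (insert u (taken p)) - I.f (taken p) ∧
      ∀ l', l ++ [u] <+: l' → l' <+: I.stream → thresholdAfter ε ℓ i₀ I.oracles l' <
        Real.exp (ε * ⌊Real.log (I.f (insert u (taken p)) - I.f (taken p)) / ε⌋)
    swap
    · exact ⟨p, hp.skip hε hε' hT hmax hl huT hv hmem⟩
    have hup : u ∉ taken p := by
      intro hu
      obtain ⟨x, hx, rfl⟩ := mem_of_mem_taken hu
      rcases hp.mem with rfl | hm
      · simp at hx
      · exact hul (htree.mem p hm x hx)
    have hR : I.CommonIndep (insert u (taken p ∪ T.filter (· ∉ l ++ [u]))) := by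
      rw [← Finset.union_insert, insert_filter_notMem_append huT hul]
      exact hp.indep
    have hdesc := fun c (hc : c < ℓ (taken p).card) => htree.exists_mem_or_candidate
      (u := u) hp.mem hc (Finset.subset_union_left (s₂ := T.filter (· ∉ l ++ [u])))
      (by simp [hup]) hR hv.1
    have hpT : taken p ∪ T ⊆ I.stream.toFinset := Finset.union_subset
      (Finset.subset_union_left.trans (I.subset_of_indep (hp.indep i₀))) hTs
    set W := (stateAfter ε ℓ i₀ I.oracles l).words with hW
    -- If some search has room for `u`, the one of least index really stores it, and taking `u ∈ T`
    -- leaves the union with `T` unchanged. Otherwise every search offers a replacement; these are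
    -- distinct, and one of them is harmless.
    by_cases hcand : ∃ c, ∃ b q, (b, u) :: q ∈ candidates ε ℓ I.oracles W u ∧
      root ((b, u) :: q) = p ∧ copy ((b, u) :: q) = c ∧ before ((b, u) :: q) = taken p
    · classical
      obtain ⟨b, q, h1, h2, h3, h4⟩ := Nat.find_spec hcand
      have hmin : ∀ y ∈ candidates ε ℓ I.oracles W u, root y = root ((b, u) :: q) →
          copy ((b, u) :: q) ≤ copy y := by
        intro y hy hroot
        rw [h3]
        refine Nat.find_min' hcand ?_
        obtain ⟨hext, hc⟩ := mem_candidates.1 hy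
        obtain ⟨q', hq', b', -, rfl⟩ := mem_extensions.1 hext
        refine ⟨b', q', hy, hroot.trans h2, rfl, ?_⟩
        rw [← h2, ← hroot]
        rcases b' with c' | i
        · rfl
        -- The set taken before the last element depends only on the root, so every candidate with
        -- root `p` competes in the minimum defining `hcand`.
        · exact htree.before_eq_taken_root (x := q') (hq'.resolve_left (hc.2.2.2 i rfl).1)
      refine ⟨(b, u) :: q, hp.take hε hε' hT hl huT hv.1 hv.2 (mem_grown.2 (.inr ⟨h1, hmin⟩)) h2
        ?_ h4 hR ?_⟩
      · rw [key, weight_cons, h4]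
      · rw [Finset.insert_eq_of_mem (Finset.mem_union_right _ huT)]
        have h5 := I.nonneg _ hpT
        have h6 : 0 ≤ ε / 2 ^ ((taken p).card + 1) * I.f (taken p ∪ T) := by positivity
        linarith
    · have hrep := fun c hc => (hdesc c hc).resolve_right fun h => hcand ⟨c, h⟩
      choose b a q h1 h2 h3 h4 h5 h6 using hrep
      have hinj : Function.Injective fun c : Fin (ℓ (taken p).card) => a c.1 c.2 := by
        intro c c' e
        have := htree.disjoint _ (h1 c.1 c.2) _ (h1 c'.1 c'.2) (by simpa using e)
          (by rw [h2, h2])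
        rw [h3, h3] at this
        exact Fin.ext this
      obtain ⟨c, hc⟩ := hℓ _ _ hpT _ hinj fun c =>
        I.subset_of_indep (h6 c.1 c.2 i₀) (by simp)
      exact ⟨_, hp.take hε hε' hT hl huT hv.1 hv.2 (mem_grown.2 (.inl (h1 c.1 c.2)))
        (h2 c.1 c.2) (h4 c.1 c.2) (h5 c.1 c.2) (h6 c.1 c.2) hc⟩

theorem approximates_alg (hε : 0 < ε) (hε' : ε < 1 / 7) (hℓ : I.HasHarmless ε ℓ) :
    (alg ε ℓ i₀).Approximates I (2 + 17 * ε) := by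
  obtain ⟨T, hT, hmax⟩ := I.exists_optimal i₀
  obtain ⟨⟨w, hw, e⟩, hbest⟩ := solution_alg ε ℓ i₀ I
  have htree := isSearchTree_stateAfter ε ℓ i₀ I List.prefix_rfl
  constructor
  · rw [e]
    rcases Finset.mem_insert.1 hw with rfl | hw
    · intro i; simp
    · intro i
      refine (htree.indep w hw i).subset (Finset.coe_subset.2 ?_)
      rw [taken, Finset.union_comm]
      exact Finset.union_subset_union_right (before_subset_spans w i)
  · intro S hS
    refine (hmax S hS).trans ?_
    obtain ⟨p, hp⟩ := exists_isProgress (i₀ := i₀) hε hε' hℓ hT hmax List.prefix_rfl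
    have h1 := hbest p (by simpa using hp.mem)
    set V := I.f ((alg ε ℓ i₀).solution I)
    have h2 := hp.harmless
    have h3 := hp.gain
    have hTs := I.subset_of_indep (hT i₀)
    rw [Finset.filter_true_of_mem fun a ha => List.mem_toFinset.1 (hTs ha)] at h3
    have hfT : 0 ≤ I.f T := I.nonneg T hTs
    have hf0 : 0 ≤ I.f ∅ := I.nonneg ∅ (by simp)
    have h4 : 2 * ε * I.f T * (1 - 1 / ((T.card : ℝ) + 1)) ≤ 2 * ε * I.f T :=
      mul_le_of_le_one_right (by positivity) (by
        have : (0 : ℝ) ≤ 1 / ((T.card : ℝ) + 1) := by positivity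
        linarith)
    have h5 : (1 - ε) * I.f T ≤ I.f (taken p ∪ T) := by
      refine le_trans (mul_le_mul_of_nonneg_right ?_ hfT) h2
      have : (0 : ℝ) ≤ ε * (1 / 2) ^ (taken p).card := by positivity
      linarith
    have h6 : (1 - ε) * ((1 - ε) * I.f T) ≤ (1 - ε) * I.f (taken p ∪ T) :=
      mul_le_mul_of_nonneg_left h5 (by linarith)
    -- The coefficient comes from `(1 - ε) ^ 2 - 2 * ε ≥ 1 - 4 * ε`.
    have h7 : (1 - 4 * ε) * I.f T ≤ (2 - ε) * V := by
      have h8 : (2 - ε) * I.f (taken p) ≤ (2 - ε) * V :=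
        mul_le_mul_of_nonneg_left h1 (by linarith)
      have h9 : 0 ≤ ε * ε * I.f T := by positivity
      nlinarith
    have hV : 0 ≤ V := by
      by_contra! hneg
      have : (2 - ε) * V < 0 := mul_neg_of_pos_of_neg (by linarith) hneg
      have : 0 ≤ (1 - 4 * ε) * I.f T := mul_nonneg (by linarith) hfT
      linarith
    -- This amounts to `68 * ε ^ 2 ≤ 10 * ε`, true because `1 / 7 < 10 / 68`.
    have h10 : 2 - ε ≤ (2 + 17 * ε) * (1 - 4 * ε) := by nlinarith
    have h11 : (1 - 4 * ε) * I.f T ≤ (1 - 4 * ε) * ((2 + 17 * ε) * V) := by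
      have := mul_le_mul_of_nonneg_right h10 hV
      linarith
    exact le_of_mul_le_mul_left h11 (by linarith)

end SearchState

/-! ### Depth and size of the tree, and the space of the algorithm. -/

namespace SearchState

open SearchWord

variable {α : Type*} [DecidableEq α] {k : ℕ} {ε : ℝ} {ℓ : ℕ → ℕ} {i₀ : Fin k}
  {I : SMkMInstance α k} {l : List α} {W : Finset (SearchWord α k)} {ρ Λ B : ℕ}

theorem IsSearchTree.card_taken_cons (h : IsSearchTree ε ℓ I l W) (i₀ : Fin k) {x p}
    (hx : x :: p ∈ W) : (taken (x :: p)).card = (before (x :: p)).card + 1 := by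
  rw [taken_cons, Finset.card_insert_of_notMem fun ha => h.notMem_spans _ _ hx i₀
    (before_subset_spans _ _ ha)]

theorem IsSearchTree.card_taken_le (h : IsSearchTree ε ℓ I l W) (i₀ : Fin k)
    (hρ : I.rank ≤ ρ) {w : SearchWord α k} (hw : w ∈ W) : (taken w).card ≤ ρ := by
  refine le_trans (Finset.card_le_card ?_) ((I.indep_card_le (h.indep w hw i₀)).trans hρ)
  rw [taken, Finset.union_comm]
  exact Finset.union_subset_union_right (before_subset_spans w i₀)

theorem IsSearchTree.card_spans_le (h : IsSearchTree ε ℓ I l W) (hρ : I.rank ≤ ρ)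
    {w : SearchWord α k} (hw : w ∈ W) (i : Fin k) : (spans w i).card ≤ ρ - 1 := by
  rcases w with _ | ⟨x, p⟩
  · exact absurd hw h.nil_notMem
  · have := (I.indep_card_le (h.indep _ hw i)).trans hρ
    rw [last_cons, ← Finset.insert_eq,
      Finset.card_insert_of_notMem (h.notMem_spans _ _ hw i)] at this
    omega

/-- A new search starts with the taken set as the record of each of the `k` matroids, and each
rejection adds one new element to exactly one record. -/
theorem IsSearchTree.numSpans_add_le (h : IsSearchTree ε ℓ I l W) {w : SearchWord α k}
    (hw : w ∈ W) : numSpans w + k * (before w).card ≤ ∑ i, (spans w i).card := by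
  induction w with
  | nil => exact absurd hw h.nil_notMem
  | cons x p ih =>
    obtain ⟨c | i, a⟩ := x
    · simp [numSpans]
    · have hp := (h.tail_mem _ _ hw).resolve_left (h.key_eq i a p hw).1
      rcases p with _ | ⟨y, q⟩
      · exact absurd hp h.nil_notMem
      have h1 := ih hp
      have h2 : ∀ j, (spans ((.inr i, a) :: y :: q) j).card =
          (spans (y :: q) j).card + if j = i then 1 else 0 := by
        intro j
        rw [spans_inr]
        split_ifs
        · rw [last_cons, Finset.union_comm, ← Finset.insert_eq,
            Finset.card_insert_of_notMem (h.notMem_spans _ _ hp j)]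
        · rfl
      simp only [h2, Finset.sum_add_distrib, Finset.sum_ite_eq', Finset.mem_univ, if_true,
        before_inr, numSpans] at h1 ⊢
      omega

theorem IsSearchTree.numSpans_le (h : IsSearchTree ε ℓ I l W) (hρ : I.rank ≤ ρ)
    {w : SearchWord α k} (hw : w ∈ W) : numSpans w ≤ k * (ρ - 1) := by
  have h1 := h.numSpans_add_le hw
  have h2 : ∑ i, (spans w i).card ≤ ∑ _i : Fin k, (ρ - 1) :=
    Finset.sum_le_sum fun i _ => h.card_spans_le hρ hw i
  simp only [Finset.sum_const, Finset.card_univ, Fintype.card_fin, smul_eq_mul] at h2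
  omega

theorem IsSearchTree.length_le (h : IsSearchTree ε ℓ I l W) (i₀ : Fin k) (hρ : I.rank ≤ ρ)
    {w : SearchWord α k} (hw : w ∈ W) :
    w.length ≤ (before w).card * (k * (ρ - 1) + 1) + numSpans w + 1 := by
  induction w with
  | nil => simp
  | cons x p ih =>
    obtain ⟨c | i, a⟩ := x
    · rcases h.tail_mem _ _ hw with rfl | hp
      · simp
      · rcases p with _ | ⟨y, q⟩
        · simp
        have h1 := ih hp
        have h2 := h.numSpans_le hρ hp
        rw [before_inl, h.card_taken_cons i₀ hp, List.length_cons, add_mul]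
        omega
    · have hp := (h.tail_mem _ _ hw).resolve_left (h.key_eq i a p hw).1
      have h1 := ih hp
      rw [before_inr, List.length_cons, numSpans]
      omega

theorem IsSearchTree.length_le' (h : IsSearchTree ε ℓ I l W) (i₀ : Fin k) (hρ : I.rank ≤ ρ)
    {w : SearchWord α k} (hw : w ∈ W) : w.length ≤ ρ * (k * (ρ - 1) + 1) := by
  rcases w with _ | ⟨x, p⟩
  · simp
  have h1 := h.length_le i₀ hρ hw
  have h2 := h.numSpans_le hρ hw
  have h3 := h.card_taken_le i₀ hρ hw
  rw [h.card_taken_cons i₀ hw] at h3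
  have h4 := Nat.mul_le_mul_right (k * (ρ - 1) + 1) h3
  rw [add_mul] at h4
  omega

theorem IsSearchTree.label_lt (h : IsSearchTree ε ℓ I l W) (i₀ : Fin k) (hρ : I.rank ≤ ρ)
    (hΛ : ∀ j < ρ, ℓ j ≤ Λ) {w : SearchWord α k} (hw : w ∈ W) {c : ℕ} {a : α}
    (hc : (.inl c, a) ∈ w) : c < Λ := by
  induction w with
  | nil => simp at hc
  | cons x p ih =>
    rcases List.mem_cons.1 hc with rfl | hc
    · have h1 := h.card_taken_le i₀ hρ hw
      rw [h.card_taken_cons i₀ hw, before_inl] at h1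
      exact (h.copy_lt c a p hw).trans_le (hΛ _ h1)
    · rcases h.tail_mem _ _ hw with rfl | hp
      · simp at hc
      · exact ih hp hc

/-- The number of branches is bounded in terms of the number of keys. -/
theorem IsSearchTree.card_le (h : IsSearchTree ε ℓ I l W) (i₀ : Fin k) (hk : 2 ≤ k)
    (hρ : I.rank ≤ ρ) (hΛ : ∀ j < ρ, ℓ j ≤ Λ) (hΛ1 : 1 ≤ Λ) (hB1 : 1 ≤ B) {E : Finset ℤ}
    (hE : E.card ≤ B) (hkey : ∀ w ∈ W, key ε I.oracles w ∈ E) :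
    (insert [] W).card ≤ 2 * (k ^ (k * (ρ - 1) + 1) * Λ * B) ^ ρ := by
  classical
  -- Branches are counted by the number `j` of taken elements and the number `r` of rejections in
  -- the current search. A rejection multiplies the count by at most `k`, as the key is inherited;
  -- starting a search multiplies it by at most `Λ * B`.
  set K := k * (ρ - 1)
  set D := k ^ (K + 1) * Λ * B with hD
  have hspan : ∀ j r, ((insert [] W).filter fun w => (taken w).card = j ∧
      numSpans w = r + 1).card ≤ k * ((insert [] W).filter fun w => (taken w).card = j ∧
      numSpans w = r).card := by
    intro j r
    have : k = ((Finset.univ : Finset (Fin k)).image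
        fun i => (some (.inr i) : Option (ℕ ⊕ Fin k))).card := by
      rw [Finset.card_image_of_injective _ fun a b e => by simpa using e]
      simp
    refine le_trans ?_ (Nat.mul_le_mul_right _ this.ge)
    rw [← Finset.card_product]
    refine Finset.card_le_card_of_injOn (fun w => (label w, w.tail)) ?_ ?_
    · intro w hw
      obtain ⟨hw, hj, hr⟩ := Finset.mem_filter.1 hw
      rcases w with _ | ⟨⟨c | i, a⟩, p⟩
      · simp [numSpans] at hr
      · simp [numSpans] at hr
      · have hw : (.inr i, a) :: p ∈ W := by simpa using hw
        have hp := (h.tail_mem _ _ hw).resolve_left (h.key_eq i a p hw).1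
        simp only [Finset.coe_product, Set.mem_prod, label_cons, List.tail_cons]
        refine ⟨by simp, Finset.mem_coe.2 (Finset.mem_filter.2 ⟨by simp [hp], ?_, ?_⟩)⟩
        · rcases p with _ | ⟨y, q⟩
          · exact absurd hp h.nil_notMem
          rw [← hj, h.card_taken_cons i₀ hp, h.card_taken_cons i₀ hw, before_inr]
        · simpa [numSpans] using hr
    · intro v hv w hw e
      obtain ⟨hv, -, hr⟩ := Finset.mem_filter.1 hv
      obtain ⟨hw, -, hr'⟩ := Finset.mem_filter.1 hw
      rcases v with _ | ⟨⟨c | i, a⟩, p⟩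
      · simp [numSpans] at hr
      · simp [numSpans] at hr
      rcases w with _ | ⟨⟨c | i', a'⟩, p'⟩
      · simp [numSpans] at hr'
      · simp [numSpans] at hr'
      simp only [label_cons, List.tail_cons, Prod.mk.injEq, Option.some.injEq, Sum.inr.injEq] at e
      obtain ⟨rfl, rfl⟩ := e
      have hv : (.inr i, a) :: p ∈ W := by simpa using hv
      have hw : (.inr i, a') :: p ∈ W := by simpa using hw
      rw [h.unique _ a a' p hv hw ((h.key_eq _ _ _ hv).2.trans (h.key_eq _ _ _ hw).2.symm)]
  have htake : ∀ j, ((insert [] W).filter fun w => (taken w).card = j + 1 ∧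
      numSpans w = 0).card ≤ Λ * B * ((insert [] W).filter fun w => (taken w).card = j).card := by
    intro j
    have : Λ = ((Finset.range Λ).image
        fun c => (some (.inl c) : Option (ℕ ⊕ Fin k))).card := by
      rw [Finset.card_image_of_injective _ fun a b e => by simpa using e]
      simp
    refine le_trans ?_ (Nat.mul_le_mul_right _ (Nat.mul_le_mul_left _ hE))
    conv_rhs => rw [this, mul_assoc, ← Finset.card_product, ← Finset.card_product]
    refine Finset.card_le_card_of_injOn (fun w => (label w, key ε I.oracles w, w.tail)) ?_ ?_
    · intro w hw
      obtain ⟨hw, hj, hr⟩ := Finset.mem_filter.1 hw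
      rcases w with _ | ⟨⟨c | i, a⟩, p⟩
      · simp at hj
      · have hw : (.inl c, a) :: p ∈ W := by simpa using hw
        simp only [Finset.coe_product, Set.mem_prod, label_cons, List.tail_cons]
        refine ⟨?_, hkey _ hw, Finset.mem_coe.2 (Finset.mem_filter.2 ⟨?_, ?_⟩)⟩
        · simpa using h.label_lt i₀ hρ hΛ hw (c := c) (a := a) (by simp)
        · simpa using h.tail_mem _ _ hw
        · rw [h.card_taken_cons i₀ hw, before_inl] at hj
          omega
      · simp [numSpans] at hr
    · intro v hv w hw e
      obtain ⟨hv, hj, hr⟩ := Finset.mem_filter.1 hv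
      obtain ⟨hw, hj', hr'⟩ := Finset.mem_filter.1 hw
      rcases v with _ | ⟨⟨b, a⟩, p⟩
      · simp at hj
      rcases w with _ | ⟨⟨b', a'⟩, p'⟩
      · simp at hj'
      simp only [label_cons, List.tail_cons, Prod.mk.injEq, Option.some.injEq] at e
      obtain ⟨rfl, e, rfl⟩ := e
      rw [h.unique _ a a' p (by simpa using hv) (by simpa using hw) e]
  have hpow : ∀ j r, ((insert [] W).filter fun w => (taken w).card = j ∧
      numSpans w = r).card ≤ k ^ r * ((insert [] W).filter fun w => (taken w).card = j ∧
      numSpans w = 0).card := by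
    intro j r
    induction r with
    | zero => simp
    | succ r ih =>
      refine (hspan j r).trans ((Nat.mul_le_mul_left k ih).trans ?_)
      rw [pow_succ, ← mul_assoc, mul_comm k]
  have hlevel : ∀ j, ((insert [] W).filter fun w => (taken w).card = j).card ≤
      k ^ (K + 1) * ((insert [] W).filter fun w => (taken w).card = j ∧
      numSpans w = 0).card := by
    intro j
    have hsub : ((insert [] W).filter fun w => (taken w).card = j) ⊆
        (Finset.range (K + 1)).biUnion fun r => (insert [] W).filter fun w =>
          (taken w).card = j ∧ numSpans w = r := by
      intro w hw
      obtain ⟨hw, hj⟩ := Finset.mem_filter.1 hw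
      refine Finset.mem_biUnion.2 ⟨numSpans w, ?_, Finset.mem_filter.2 ⟨hw, hj, rfl⟩⟩
      rw [Finset.mem_range, Nat.lt_succ_iff]
      rcases Finset.mem_insert.1 hw with rfl | hw
      · simp [numSpans]
      · exact h.numSpans_le hρ hw
    refine (Finset.card_le_card hsub).trans (Finset.card_biUnion_le.trans ?_)
    refine (Finset.sum_le_sum fun r _ => hpow j r).trans ?_
    rw [← Finset.sum_mul]
    -- Here `2 ≤ k` is essential: the powers `k ^ r` with `r ≤ K` sum to less than `k ^ (K + 1)`.
    refine Nat.mul_le_mul_right _ (Nat.geomSum_lt hk fun r hr => Finset.mem_range.1 hr).le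
  have hN : ∀ j, ((insert [] W).filter fun w => (taken w).card = j).card ≤ D ^ j := by
    intro j
    induction j with
    | zero =>
      rw [pow_zero, Finset.card_le_one_iff_subset_singleton]
      refine ⟨[], fun w hw => ?_⟩
      obtain ⟨hw, hj⟩ := Finset.mem_filter.1 hw
      rcases w with _ | ⟨x, p⟩
      · simp
      · rw [h.card_taken_cons i₀ (by simpa using hw)] at hj
        omega
    | succ j ih =>
      refine (hlevel _).trans ((Nat.mul_le_mul_left _ ((htake j).trans
        (Nat.mul_le_mul_left _ ih))).trans ?_)
      rw [pow_succ, hD]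
      exact le_of_eq (by ring)
  have hD2 : 2 ≤ D := by
    have h1 : k ≤ k ^ (K + 1) := Nat.le_self_pow (by omega) k
    calc 2 ≤ k ^ (K + 1) * 1 * 1 := by omega
      _ ≤ D := Nat.mul_le_mul (Nat.mul_le_mul_left _ hΛ1) hB1
  have hsub : insert [] W ⊆ (Finset.range (ρ + 1)).biUnion fun j => (insert [] W).filter fun w =>
      (taken w).card = j := by
    intro w hw
    refine Finset.mem_biUnion.2 ⟨(taken w).card, ?_, Finset.mem_filter.2 ⟨hw, rfl⟩⟩
    rw [Finset.mem_range, Nat.lt_succ_iff]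
    rcases Finset.mem_insert.1 hw with rfl | hw
    · simp
    · exact h.card_taken_le i₀ hρ hw
  refine (Finset.card_le_card hsub).trans (Finset.card_biUnion_le.trans ?_)
  refine (Finset.sum_le_sum fun r _ => hN r).trans ?_
  rw [Finset.sum_range_succ]
  have := (Nat.geomSum_lt (s := Finset.range ρ) (n := ρ) hD2 fun r hr => Finset.mem_range.1 hr).le
  omega

/-- The number of keys is bounded. -/
theorem exists_keys (hε : 0 < ε) (i₀ : Fin k) (hl : l <+: I.stream) (hρ : I.rank ≤ ρ)
    (hρ1 : 1 ≤ ρ) (hε1 : ε < 1) :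
    ∃ (B : ℕ) (E : Finset ℤ), 1 ≤ B ∧ (B : ℝ) ≤ Real.log (ρ * (ρ + 1) / ε) / ε + 1 ∧
      E.card ≤ B ∧ ∀ w ∈ (stateAfter ε ℓ i₀ I.oracles l).words, key ε I.oracles w ∈ E := by
  have htree := isSearchTree_stateAfter ε ℓ i₀ I hl
  have hρ' : (1 : ℝ) ≤ ρ := by exact_mod_cast hρ1
  have hlog0 : 0 ≤ Real.log (ρ * (ρ + 1) / ε) / ε := by
    refine div_nonneg (Real.log_nonneg ?_) hε.le
    rw [le_div_iff₀ hε]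
    nlinarith
  rcases (stateAfter ε ℓ i₀ I.oracles l).words.eq_empty_or_nonempty with h0 | ⟨w₀, hw₀⟩
  · exact ⟨1, ∅, le_rfl, by simpa using hlog0, by simp, by simp [h0]⟩
  obtain ⟨hb1, hb2, hb3⟩ := best_stateAfter ε ℓ i₀ I l
  set s := stateAfter ε ℓ i₀ I.oracles l with hs
  set m := I.f s.best.toFinset - I.f ∅ with hm
  have hsingle : ∀ x p, x :: p ∈ s.words → I.CommonIndep {x.2} ∧ x.2 ∈ l := fun x p hx =>
    ⟨fun i => (htree.indep _ hx i).subset (by simp), htree.mem _ hx x (by simp)⟩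
  -- By submodularity a gain is at most the gain over `∅`, and the last element of a branch is a
  -- feasible singleton. So all gains lie between the threshold and `m`, whose ratio is `g * (g + 1)
  -- / ε` for a basis of size `g`.
  have hwm : ∀ w ∈ s.words, weight I.oracles w ≤ m := by
    intro w hw
    rcases w with _ | ⟨⟨b, a⟩, p⟩
    · exact absurd hw htree.nil_notMem
    obtain ⟨h1, h2⟩ := hsingle _ _ hw
    rw [weight_cons]
    have h3 := hb3 a h2 h1
    have h4 := I.subset_of_indep (htree.indep _ hw i₀)
    have h5 := I.submodular ∅ (before ((b, a) :: p)) (by simp)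
      ((before_subset_spans _ i₀).trans (Finset.subset_union_right.trans h4)) a (by
        simp only [Finset.mem_sdiff]
        exact ⟨h4 (by simp), fun ha => htree.notMem_spans _ _ hw i₀ (before_subset_spans _ _ ha)⟩)
    simp only [insert_empty_eq] at h5
    linarith
  have hm0 : 0 < m := (htree.weight_pos _ hw₀).trans_le (hwm _ hw₀)
  have hg : 1 ≤ s.base.card := by
    rcases w₀ with _ | ⟨⟨b, a⟩, p⟩
    · exact absurd hw₀ htree.nil_notMem
    obtain ⟨h1, h2⟩ := hsingle _ _ hw₀
    simpa using card_le_card_base ε ℓ i₀ I hl h1 (by simpa using h2)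
  have hgρ : s.base.card ≤ ρ := (I.indep_card_le (base_stateAfter ε ℓ i₀ I hl).1).trans hρ
  have hg' : (1 : ℝ) ≤ s.base.card := by exact_mod_cast hg
  have hgρ' : (s.base.card : ℝ) ≤ ρ := by exact_mod_cast hgρ
  set τ := thresholdAfter ε ℓ i₀ I.oracles l with hτ
  have hτe : τ = ε * m / (s.base.card * (s.base.card + 1)) := rfl
  have hτ0 : 0 < τ := by rw [hτe]; positivity
  have hdiff : Real.log m / ε - Real.log τ / ε ≤ Real.log (ρ * (ρ + 1) / ε) / ε := by
    rw [← sub_div, ← Real.log_div hm0.ne' hτ0.ne']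
    have e : m / τ = s.base.card * (s.base.card + 1) / ε := by
      rw [hτe]; field_simp
    rw [e]
    gcongr
  refine ⟨max 1 (Finset.Icc (⌊Real.log τ / ε⌋ + 1) ⌊Real.log m / ε⌋).card, _, le_max_left _ _, ?_,
    le_max_right _ _, fun w hw => ?_⟩
  · rw [Nat.cast_max, Nat.cast_one]
    refine max_le (by linarith) ?_
    rw [Int.card_Icc]
    have h1 := Int.lt_floor_add_one (Real.log τ / ε)
    have h2 := Int.floor_le (Real.log m / ε)
    have h3 : (((⌊Real.log m / ε⌋ + 1 - (⌊Real.log τ / ε⌋ + 1)).toNat : ℤ) : ℝ) ≤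
        Real.log (ρ * (ρ + 1) / ε) / ε + 1 := by
      rw [Int.toNat_eq_max]
      push_cast
      refine max_le ?_ (by linarith)
      linarith
    exact_mod_cast h3
  · have hw0 := htree.weight_pos w hw
    have h1 := threshold_lt ε ℓ i₀ I.oracles l hw
    rw [← hτ, ← Real.log_lt_iff_lt_exp hτ0] at h1
    rw [Finset.mem_Icc]
    constructor
    · rw [Int.add_one_le_iff, Int.floor_lt, div_lt_iff₀ hε]
      linarith
    · refine Int.floor_mono ?_
      have := Real.log_le_log hw0 (hwm w hw)
      gcongr

theorem card_valueQueries_le (s : SearchState α k) (u : α) :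
    (valueQueries s u).card ≤ 3 + (insert [] s.words).card * 4 := by
  refine (Finset.card_union_le _ _).trans (add_le_add Finset.card_le_three ?_)
  exact Finset.card_biUnion_le_card_mul _ _ _ fun p _ => Finset.card_le_four

theorem card_indepQueries_le (i₀ : Fin k) (s : SearchState α k) (u : α) :
    (indepQueries i₀ s u).card ≤ k * (insert [] s.words).card * 3 + 1 := by
  refine (Finset.card_insert_le _ _).trans (Nat.add_le_add_right ?_ 1)
  refine (Finset.card_biUnion_le_card_mul _ _ 3 fun p _ => Finset.card_le_three).trans ?_
  simp

theorem length_encode_le (i₀ : Fin k) {s : SearchState α k} (h : IsSearchTree ε ℓ I l s.words)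
    (hρ : I.rank ≤ ρ) (hΛ : ∀ j < ρ, ℓ j ≤ Λ) (hbase : s.base.card ≤ ρ) :
    s.encode.length ≤ (insert [] s.words).card *
      (ρ * (k * (ρ - 1) + 1) * (Λ + k + 3 + 1) + 1 + 1) + 1 + (ρ * 2 + 1 + 3) := by
  rw [encode, List.length_append, List.length_append]
  refine add_le_add ?_ (add_le_add ?_ ?_)
  · refine (MemCode.length_encList_le (n := ρ * (k * (ρ - 1) + 1) * (Λ + k + 3 + 1) + 1)
      fun w hw => ?_).trans ?_
    · rw [Finset.mem_toList] at hw
      -- A letter takes a tag bit, a unary number below `Λ` or `k` with its end bit, and a cell for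
      -- the element.
      refine (MemCode.length_encList_le (n := Λ + k + 3) fun x hx => ?_).trans ?_
      · obtain ⟨c | i, a⟩ := x
        · have := h.label_lt i₀ hρ hΛ hw hx
          simp only [MemCode.encPair, MemCode.encLabel, MemCode.encNat, MemCode.encElem,
            List.length_append, List.length_cons, List.length_nil, List.length_replicate]
          omega
        · have := i.2
          simp only [MemCode.encPair, MemCode.encLabel, MemCode.encNat, MemCode.encElem,
            List.length_append, List.length_cons, List.length_nil, List.length_replicate]
          omega
      · exact Nat.add_le_add_right (Nat.mul_le_mul_right _ (h.length_le' i₀ hρ hw)) 1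
    · rw [Finset.length_toList]
      exact Nat.add_le_add_right (Nat.mul_le_mul_right _
        (Finset.card_le_card (Finset.subset_insert _ _))) 1
  · refine (MemCode.length_encList_le (n := 1) fun x hx => by simp [MemCode.encElem]).trans ?_
    rw [Finset.length_toList]
    omega
  · refine (MemCode.length_encList_le (n := 1) fun x hx => by simp [MemCode.encElem]).trans ?_
    cases s.best <;> simp

theorem spaceAtMost_alg (hε : 0 < ε) (hε1 : ε < 1) (hk : 2 ≤ k) (hρ : I.rank ≤ ρ) (hρ1 : 1 ≤ ρ)
    (hΛ : ∀ j < ρ, ℓ j ≤ Λ) (hΛ1 : 1 ≤ Λ) :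
    (alg ε ℓ i₀).SpaceAtMost I (22 * ((k : ℝ) ^ (k * (ρ - 1) + 1) * Λ *
      (Real.log (ρ * (ρ + 1) / ε) / ε + 1)) ^ ρ * ((k : ℝ) ^ 2 * ρ ^ 2 * Λ)) := by
  have key : ∀ l, l <+: I.stream → ((((stateAfter ε ℓ i₀ I.oracles l).encode.length + 1 +
      (3 + (insert [] (stateAfter ε ℓ i₀ I.oracles l).words).card * 4 +
      (k * (insert [] (stateAfter ε ℓ i₀ I.oracles l).words).card * 3 + 1)) : ℕ)) : ℝ) ≤
      22 * ((k : ℝ) ^ (k * (ρ - 1) + 1) * Λ *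
      (Real.log (ρ * (ρ + 1) / ε) / ε + 1)) ^ ρ * ((k : ℝ) ^ 2 * ρ ^ 2 * Λ) := by
    intro l hl
    have htree := isSearchTree_stateAfter ε ℓ i₀ I hl
    obtain ⟨B, E, hB1, hB, hE, hkey⟩ := exists_keys (ℓ := ℓ) hε i₀ hl hρ hρ1 hε1
    have hcard := htree.card_le i₀ hk hρ hΛ hΛ1 hB1 hE hkey
    have hlen := length_encode_le i₀ htree hρ hΛ
      ((I.indep_card_le (base_stateAfter ε ℓ i₀ I hl).1).trans hρ)
    have hn : 1 ≤ (insert [] (stateAfter ε ℓ i₀ I.oracles l).words).card :=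
      Finset.card_pos.2 (Finset.insert_nonempty _ _)
    generalize (insert [] (stateAfter ε ℓ i₀ I.oracles l).words).card = n at *
    generalize (stateAfter ε ℓ i₀ I.oracles l).encode.length = L at *
    have hX : L + 1 + (3 + n * 4 + (k * n * 3 + 1)) ≤ 11 * (n * (k ^ 2 * ρ ^ 2 * Λ)) := by
      have h1 : k * (ρ - 1) + 1 ≤ k * ρ := by
        obtain ⟨r, rfl⟩ := Nat.exists_eq_add_of_le' hρ1
        rw [Nat.add_sub_cancel, Nat.mul_add]
        omega
      have h2 : Λ + k + 3 + 1 ≤ 4 * (k * Λ) := by nlinarith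
      have h3 : ρ * (k * (ρ - 1) + 1) * (Λ + k + 3 + 1) ≤ 4 * (k ^ 2 * ρ ^ 2 * Λ) := by
        calc _ ≤ ρ * (k * ρ) * (4 * (k * Λ)) := by gcongr
          _ = _ := by ring
      have h4 : k * k * (ρ * ρ) ≤ k ^ 2 * ρ ^ 2 * Λ := by
        calc k * k * (ρ * ρ) = k ^ 2 * ρ ^ 2 * 1 := by ring
          _ ≤ _ := by gcongr
      have h5 : 2 * k ≤ k ^ 2 * ρ ^ 2 * Λ := by
        refine le_trans ?_ h4
        have : 1 ≤ ρ * ρ := Nat.mul_pos hρ1 hρ1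
        nlinarith
      have h6 : 4 * ρ ≤ k ^ 2 * ρ ^ 2 * Λ := by
        refine le_trans ?_ h4
        nlinarith [Nat.mul_le_mul hk hk, Nat.mul_le_mul hρ1 (le_refl ρ)]
      generalize k ^ 2 * ρ ^ 2 * Λ = Z at *
      have h7 : n * (ρ * (k * (ρ - 1) + 1) * (Λ + k + 3 + 1) + 1 + 1) ≤ n * (4 * Z + 2) :=
        Nat.mul_le_mul_left _ (by omega)
      have h8 : Z ≤ n * Z := Nat.le_mul_of_pos_left _ hn
      have h9 : n * (2 * k) ≤ n * Z := Nat.mul_le_mul_left _ h5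
      have h10 : n * 4 ≤ n * Z := Nat.mul_le_mul_left _ (by omega)
      have h11 : n * (4 * Z + 2) = 4 * (n * Z) + n * 2 := by ring
      have h12 : n * (2 * k) = 2 * (k * n) := by ring
      omega
    have hreal : ((n : ℕ) : ℝ) ≤ 2 * ((k : ℝ) ^ (k * (ρ - 1) + 1) * Λ *
        (Real.log (ρ * (ρ + 1) / ε) / ε + 1)) ^ ρ := by
      calc (n : ℝ) ≤ 2 * ((k : ℝ) ^ (k * (ρ - 1) + 1) * Λ * B) ^ ρ := by exact_mod_cast hcard
        _ ≤ _ := by gcongr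
    calc ((L + 1 + (3 + n * 4 + (k * n * 3 + 1)) : ℕ) : ℝ)
        ≤ ((11 * (n * (k ^ 2 * ρ ^ 2 * Λ)) : ℕ) : ℝ) := by exact_mod_cast hX
      _ = 11 * (n * ((k : ℝ) ^ 2 * ρ ^ 2 * Λ)) := by push_cast; ring
      _ ≤ 11 * ((2 * ((k : ℝ) ^ (k * (ρ - 1) + 1) * Λ *
        (Real.log (ρ * (ρ + 1) / ε) / ε + 1)) ^ ρ) * ((k : ℝ) ^ 2 * ρ ^ 2 * Λ)) := by gcongr
      _ = _ := by ring
  constructor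
  · intro l u hl
    refine le_trans ?_ (key l ((List.prefix_append l [u]).trans hl))
    rw [memoryAfter_alg]
    simp only [alg, decode_encode, QueryProgram.ask_numQueries, Finset.length_toList]
    have h1 := card_valueQueries_le (stateAfter ε ℓ i₀ I.oracles l) u
    have h2 := card_indepQueries_le i₀ (stateAfter ε ℓ i₀ I.oracles l) u
    exact_mod_cast (by omega)
  · refine le_trans ?_ (key I.stream List.prefix_rfl)
    rw [memoryAfter_alg]
    simp only [alg, decode_encode, QueryProgram.ask_numQueries, Finset.length_toList,
      List.length_nil]
    have h1 := Finset.card_image_le (s := insert [] (stateAfter ε ℓ i₀ I.oracles I.stream).words)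
      (f := taken)
    exact_mod_cast (by omega)

end SearchState

/-! ### Comparison of the space with the stated bounds. -/

section SpaceBounds

variable {k ρ : ℕ} {ε : ℝ}

theorem one_le_log_sum (k ρ : ℕ) (hε : 0 < ε) (hε' : ε < 1 / 7) :
    1 ≤ Real.log ρ + Real.log k + Real.log ε⁻¹ := by
  have h1 : 0 ≤ Real.log ρ := Real.log_natCast_nonneg ρ
  have h2 : 0 ≤ Real.log k := Real.log_natCast_nonneg k
  have h3 : 1 ≤ Real.log ε⁻¹ := by
    rw [Real.le_log_iff_exp_le (by positivity)]
    have h4 : 7 ≤ ε⁻¹ := by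
      rw [le_inv_comm₀ (by norm_num) hε]
      linarith
    linarith [Real.exp_one_lt_d9]
  linarith

theorem key_bound_le (hk : 2 ≤ k) (hρ : 1 ≤ ρ) (hε : 0 < ε) (hε' : ε < 1 / 7) :
    Real.log (ρ * (ρ + 1) / ε) / ε + 1 ≤
      3 * (Real.log ρ + Real.log k + Real.log ε⁻¹) / ε := by
  have h1 := one_le_log_sum k ρ hε hε'
  have hρ' : (1 : ℝ) ≤ ρ := by exact_mod_cast hρ
  have hk' : (2 : ℝ) ≤ k := by exact_mod_cast hk
  have h2 : Real.log (ρ * (ρ + 1) / ε) ≤ 2 * (Real.log ρ + Real.log k + Real.log ε⁻¹) := by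
    have h3 : Real.log (ρ * (ρ + 1) / ε) ≤ Real.log (ρ * (ρ * k) * ε⁻¹) := by
      refine Real.log_le_log (by positivity) ?_
      rw [div_eq_mul_inv]
      gcongr
      nlinarith
    rw [Real.log_mul (by positivity) (by positivity), Real.log_mul (by positivity) (by positivity),
      Real.log_mul (by positivity) (by positivity)] at h3
    have h4 : 0 ≤ Real.log k := Real.log_natCast_nonneg k
    have h5 : 0 ≤ Real.log ε⁻¹ := Real.log_nonneg (by
      rw [one_le_inv₀ hε]; linarith)
    linarith
  rw [div_add_one hε.ne']
  gcongr
  linarith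

/-- The spare factor `1 / 2`, available since `k * (ρ - 1) + 2 ≤ ρ * k`, turns the constant 3 of
`key_bound_le` into `3 / 2`, small enough for `polynomial_factor_le`. -/
theorem pow_search_depth_le (hk : 2 ≤ k) (hρ : 1 ≤ ρ) :
    (k : ℝ) ^ (k * (ρ - 1) + 1) ≤ (k : ℝ) ^ (ρ * k) / 2 := by
  have hk' : (2 : ℝ) ≤ k := by exact_mod_cast hk
  rw [le_div_iff₀ two_pos]
  calc (k : ℝ) ^ (k * (ρ - 1) + 1) * 2 ≤ (k : ℝ) ^ (k * (ρ - 1) + 1) * k := by gcongr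
    _ = (k : ℝ) ^ (k * (ρ - 1) + 2) := by rw [← pow_succ]
    _ ≤ (k : ℝ) ^ (ρ * k) := by
      refine pow_le_pow_right₀ (by linarith) ?_
      obtain ⟨r, rfl⟩ := Nat.exists_eq_add_of_le' hρ
      rw [Nat.add_sub_cancel, add_mul, mul_comm k r]
      omega

theorem four_pow_le (hk : 2 ≤ k) : (4 : ℝ) ^ ρ ≤ (k : ℝ) ^ (ρ * k) := by
  have hk' : (2 : ℝ) ≤ k := by exact_mod_cast hk
  calc (4 : ℝ) ^ ρ = 2 ^ (ρ * 2) := by rw [mul_comm, pow_mul]; norm_num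
    _ ≤ (k : ℝ) ^ (ρ * 2) := by gcongr
    _ ≤ (k : ℝ) ^ (ρ * k) := pow_le_pow_right₀ (by linarith) (Nat.mul_le_mul_left _ hk)

theorem polynomial_factor_le (hk : 2 ≤ k) (hρ : 1 ≤ ρ) :
    (3 / 2 : ℝ) ^ ρ * ((k : ℝ) ^ 2 * ρ) ≤ 4 * (k : ℝ) ^ (ρ * k) := by
  have hk' : (2 : ℝ) ≤ k := by exact_mod_cast hk
  have h1 : (ρ : ℝ) ≤ 2 ^ ρ := by exact_mod_cast (Nat.lt_two_pow_self (n := ρ)).le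
  calc (3 / 2 : ℝ) ^ ρ * ((k : ℝ) ^ 2 * ρ) ≤ (3 / 2 : ℝ) ^ ρ * ((k : ℝ) ^ 2 * 2 ^ ρ) := by gcongr
    _ = 3 ^ ρ * (k : ℝ) ^ 2 := by
      rw [mul_left_comm, ← mul_pow, mul_comm]; norm_num
    _ ≤ 4 ^ ρ * (k : ℝ) ^ 2 := by gcongr; norm_num
    _ ≤ 4 * (k : ℝ) ^ (ρ * k) := by
      obtain ⟨r, rfl⟩ := Nat.exists_eq_add_of_le' hρ
      have h2 := four_pow_le (ρ := r) hk
      have h3 : (k : ℝ) ^ 2 ≤ (k : ℝ) ^ k := pow_le_pow_right₀ (by linarith) hk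
      calc (4 : ℝ) ^ (r + 1) * (k : ℝ) ^ 2 = 4 * (4 ^ r * (k : ℝ) ^ 2) := by ring
        _ ≤ 4 * ((k : ℝ) ^ (r * k) * (k : ℝ) ^ k) := by gcongr
        _ = _ := by rw [← pow_add, add_mul, one_mul]

theorem space_le_monotoneSpaceBound (hk : 2 ≤ k) (hρ : 1 ≤ ρ) (hε : 0 < ε) (hε' : ε < 1 / 7) :
    22 * ((k : ℝ) ^ (k * (ρ - 1) + 1) * (1 : ℕ) * (Real.log (ρ * (ρ + 1) / ε) / ε + 1)) ^ ρ *
      ((k : ℝ) ^ 2 * ρ ^ 2 * (1 : ℕ)) ≤ 88 * monotoneSpaceBound k ρ ε := by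
  have h1 := one_le_log_sum k ρ hε hε'
  have h2 := key_bound_le hk hρ hε hε'
  have h3 := pow_search_depth_le hk hρ
  have h4 := polynomial_factor_le hk hρ
  have hρ' : (1 : ℝ) ≤ ρ := by exact_mod_cast hρ
  have hB : 0 ≤ Real.log (ρ * (ρ + 1) / ε) / ε + 1 := by
    refine add_nonneg (div_nonneg (Real.log_nonneg ?_) hε.le) zero_le_one
    rw [le_div_iff₀ hε]
    nlinarith
  rw [monotoneSpaceBound]
  set L := Real.log ρ + Real.log k + Real.log ε⁻¹
  set X := (k : ℝ) ^ (ρ * k)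
  have hX : 0 < X := by positivity
  have h5 : 1 ≤ L ^ 2 / ε := by
    rw [one_le_div₀ hε]
    nlinarith
  simp only [Nat.cast_one, mul_one]
  calc _ ≤ 22 * (X / 2 * (3 * L / ε)) ^ ρ * ((k : ℝ) ^ 2 * ρ ^ 2) := by gcongr
    _ = 22 * ((X / ε) ^ ρ * L ^ ρ) * ρ * ((3 / 2 : ℝ) ^ ρ * ((k : ℝ) ^ 2 * ρ)) := by
      rw [show X / 2 * (3 * L / ε) = (3 / 2) * ((X / ε) * L) by ring, mul_pow, mul_pow]
      ring
    -- The polynomial factors are absorbed by the additional factor `X` that the exponent `ρ + 1`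
    -- provides.
    _ ≤ 22 * ((X / ε) ^ ρ * L ^ ρ) * ρ * (4 * X) := by gcongr
    _ = 88 * ((X / ε) ^ ρ * L ^ ρ) * ρ * X * 1 := by ring
    _ ≤ 88 * ((X / ε) ^ ρ * L ^ ρ) * ρ * X * (L ^ 2 / ε) := by gcongr
    _ = _ := by rw [pow_succ (X / ε), pow_add L]; ring

theorem space_le_generalSpaceBound (hk : 2 ≤ k) (hρ : 1 ≤ ρ) (hε : 0 < ε) (hε' : ε < 1 / 7) :
    22 * ((k : ℝ) ^ (k * (ρ - 1) + 1) * (⌈(2 : ℝ) ^ ρ / ε⌉₊ : ℕ) *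
      (Real.log (ρ * (ρ + 1) / ε) / ε + 1)) ^ ρ *
      ((k : ℝ) ^ 2 * ρ ^ 2 * (⌈(2 : ℝ) ^ ρ / ε⌉₊ : ℕ)) ≤ 176 * generalSpaceBound k ρ ε := by
  have h1 := one_le_log_sum k ρ hε hε'
  have h2 := key_bound_le hk hρ hε hε'
  have h3 := pow_search_depth_le hk hρ
  have h4 := polynomial_factor_le hk hρ
  have h4' := four_pow_le (ρ := ρ) hk
  have hρ' : (1 : ℝ) ≤ ρ := by exact_mod_cast hρ
  have hB : 0 ≤ Real.log (ρ * (ρ + 1) / ε) / ε + 1 := by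
    refine add_nonneg (div_nonneg (Real.log_nonneg ?_) hε.le) zero_le_one
    rw [le_div_iff₀ hε]
    nlinarith
  have hΛ : (⌈(2 : ℝ) ^ ρ / ε⌉₊ : ℝ) ≤ 2 * (2 ^ ρ / ε) := by
    have h6 := (Nat.ceil_lt_add_one (by positivity : 0 ≤ (2 : ℝ) ^ ρ / ε)).le
    have h7 : 1 ≤ (2 : ℝ) ^ ρ / ε := by
      rw [one_le_div₀ hε]
      have : (1 : ℝ) ≤ 2 ^ ρ := one_le_pow₀ (by norm_num)
      linarith
    linarith
  have hX2 : (k : ℝ) ^ (2 * ρ * k) = ((k : ℝ) ^ (ρ * k)) ^ 2 := by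
    rw [← pow_mul]; congr 1; ring
  rw [generalSpaceBound, hX2]
  set L := Real.log ρ + Real.log k + Real.log ε⁻¹
  set X := (k : ℝ) ^ (ρ * k)
  set Λ := (⌈(2 : ℝ) ^ ρ / ε⌉₊ : ℝ)
  have hX : 0 < X := by positivity
  clear_value X L
  have h2X : (2 : ℝ) ^ ρ ≤ X := by
    refine le_trans ?_ h4'
    gcongr
    norm_num
  have hL2 : 1 ≤ L ^ 2 := one_le_pow₀ h1
  have hεinv : 1 ≤ ε⁻¹ := by rw [one_le_inv₀ hε]; linarith
  calc _ ≤ 22 * (X / 2 * (2 * (2 ^ ρ / ε)) * (3 * L / ε)) ^ ρ *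
        ((k : ℝ) ^ 2 * ρ ^ 2 * (2 * (2 ^ ρ / ε))) := by gcongr
    _ = 44 * (2 ^ ρ) ^ ρ * ((3 / 2 : ℝ) ^ ρ * ((k : ℝ) ^ 2 * ρ)) * (2 ^ ρ * 2 ^ ρ) *
        (X ^ ρ * L ^ ρ * (ε⁻¹ ^ 2) ^ ρ * ε⁻¹ * ρ) := by
      rw [show X / 2 * (2 * (2 ^ ρ / ε)) * (3 * L / ε) =
        2 ^ ρ * (3 / 2 * (2 * (X * L * ε⁻¹ ^ 2))) by ring, mul_pow (2 ^ ρ), mul_pow (3 / 2),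
        mul_pow 2, mul_pow _ (ε⁻¹ ^ 2), mul_pow X]
      ring
    _ = 44 * (2 ^ ρ) ^ ρ * ((3 / 2 : ℝ) ^ ρ * ((k : ℝ) ^ 2 * ρ)) * 4 ^ ρ *
        (X ^ ρ * L ^ ρ * (ε⁻¹ ^ 2) ^ ρ * ε⁻¹ * ρ) := by
      rw [← mul_pow 2 2]; norm_num
    -- The number of disjoint searches contributes `(2 ^ ρ) ^ ρ ≤ X ^ ρ` and a factor `4 ^ ρ ≤ X`;
    -- the square of `X` in the general bound pays for both.
    _ ≤ 44 * X ^ ρ * (4 * X) * X * (X ^ ρ * (L ^ ρ * L ^ 2) * (ε⁻¹ ^ 3) ^ ρ * ε⁻¹ ^ 3 * ρ) := by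
      gcongr
      · exact le_mul_of_one_le_right (by positivity) hL2
      · norm_num
      · exact le_self_pow₀ hεinv (by norm_num)
    _ = _ := by
      rw [pow_succ (X ^ 2 / ε ^ 3), pow_add L, div_eq_mul_inv, ← inv_pow, mul_pow (X ^ 2)]
      ring

theorem generalSpaceBound_le (hk : 2 ≤ k) (hρ : 1 ≤ ρ) (hε : 0 < ε) (hε' : ε < 1 / 7) :
    generalSpaceBound k ρ ε ≤ ((k : ℝ) ^ (ρ ^ 2 * k) * ε⁻¹ ^ ρ) ^ 9 := by
  have h1 := one_le_log_sum k ρ hε hε'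
  have hρ' : (1 : ℝ) ≤ ρ := by exact_mod_cast hρ
  have hk' : (2 : ℝ) ≤ k := by exact_mod_cast hk
  have hεinv : 1 ≤ ε⁻¹ := by rw [one_le_inv₀ hε]; linarith
  have hX2 : (k : ℝ) ^ (2 * ρ * k) = ((k : ℝ) ^ (ρ * k)) ^ 2 := by
    rw [← pow_mul]; congr 1; ring
  have hP : (k : ℝ) ^ (ρ ^ 2 * k) = ((k : ℝ) ^ (ρ * k)) ^ ρ := by
    rw [← pow_mul]; congr 1; ring
  have hL : Real.log ρ + Real.log k + Real.log ε⁻¹ ≤ ρ * k * ε⁻¹ := by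
    rw [← Real.log_mul (by positivity) (by positivity),
      ← Real.log_mul (by positivity) (by positivity)]
    exact Real.log_le_self (by positivity)
  have hX : ρ * k ≤ (k : ℝ) ^ (ρ * k) := by
    obtain ⟨r, rfl⟩ := Nat.exists_eq_add_of_le' hρ
    have h2 : ((r + 1 : ℕ) : ℝ) ≤ 2 ^ r := by exact_mod_cast (Nat.lt_two_pow_self (n := r))
    calc ((r + 1 : ℕ) : ℝ) * k ≤ 2 ^ r * k := by gcongr
      _ ≤ (k : ℝ) ^ r * k := by gcongr
      _ = (k : ℝ) ^ (r + 1) := (pow_succ _ _).symm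
      _ ≤ _ := pow_le_pow_right₀ (by linarith) (Nat.le_mul_of_pos_right _ (by omega))
  rw [generalSpaceBound, hX2, hP]
  set L := Real.log ρ + Real.log k + Real.log ε⁻¹
  set X := (k : ℝ) ^ (ρ * k)
  have hX1 : 1 ≤ X := one_le_pow₀ (by linarith)
  clear_value X L
  have hXρ : ρ ≤ X ^ ρ := by
    refine le_trans ?_ (hX.trans (le_self_pow₀ hX1 (by omega)))
    nlinarith
  have hXε : 1 ≤ X * ε⁻¹ := one_le_mul_of_one_le_of_one_le hX1 hεinv
  have hXε2 : 1 ≤ X ^ 2 / ε ^ 3 := by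
    rw [div_eq_mul_inv, ← inv_pow]
    exact one_le_mul_of_one_le_of_one_le (one_le_pow₀ hX1) (one_le_pow₀ hεinv)
  calc (X ^ 2 / ε ^ 3) ^ (ρ + 1) * L ^ (ρ + 2) * ρ
      -- From `ρ + 1 ≤ 2 * ρ`, `ρ + 2 ≤ 3 * ρ` and `L ≤ X * ε⁻¹`. The exponent of `ε⁻¹` is then `6 *
      -- ρ + 3 * ρ`, which is the source of the 9.
      ≤ (X ^ 2 / ε ^ 3) ^ (2 * ρ) * (X * ε⁻¹) ^ (3 * ρ) * X ^ ρ := by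
        gcongr
        · omega
        · calc L ^ (ρ + 2) ≤ (X * ε⁻¹) ^ (ρ + 2) := by
                gcongr
                exact hL.trans (by gcongr)
            _ ≤ _ := pow_le_pow_right₀ hXε (by omega)
    _ = X ^ (8 * ρ) * ε⁻¹ ^ (9 * ρ) := by
      rw [div_eq_mul_inv, ← inv_pow, mul_pow, mul_pow, ← pow_mul, ← pow_mul]
      ring
    _ ≤ X ^ (9 * ρ) * ε⁻¹ ^ (9 * ρ) := by
      gcongr
      norm_num
    _ = _ := by rw [mul_pow, ← pow_mul, ← pow_mul, mul_comm ρ 9]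

theorem monotoneSpaceBound_nonneg (hk : 2 ≤ k) (hρ : 1 ≤ ρ) (hε : 0 < ε) (hε' : ε < 1 / 7) :
    0 ≤ monotoneSpaceBound k ρ ε := by
  have := one_le_log_sum k ρ hε hε'
  unfold monotoneSpaceBound
  positivity

end SpaceBounds

/-! ### Assembly of the two statements. -/

namespace DataStreamAlg

variable {α : Type*} [DecidableEq α] {k : ℕ} {A : DataStreamAlg α k} {I : SMkMInstance α k}

theorem SpaceAtMost.mono {s t : ℝ} (h : A.SpaceAtMost I s) (hst : s ≤ t) : A.SpaceAtMost I t :=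
  ⟨fun l u hl => (h.1 l u hl).trans hst, h.2.trans hst⟩

theorem Approximates.mono {c d : ℝ} (i₀ : Fin k) (h : A.Approximates I c) (hcd : c ≤ d) :
    A.Approximates I d :=
  ⟨h.1, fun T hT => (h.2 T hT).trans (mul_le_mul_of_nonneg_right hcd
    (I.nonneg _ (I.subset_of_indep (h.1 i₀))))⟩

end DataStreamAlg

theorem theorem3 :
    ∃ C : ℝ, 0 < C ∧ ∃ d : ℕ, ∀ ε : ℝ, 0 < ε → ε < 1 / 7 → ∀ k : ℕ, 2 ≤ k →
      ∀ (α : Type*) [DecidableEq α],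
        (∃ A : DataStreamAlg α k, ∀ I : SMkMInstance α k,
          A.Approximates I (2 + C * ε) ∧
          A.SpaceAtMost I (C * generalSpaceBound k (max 1 I.rank) ε) ∧
          A.SpaceAtMost I
            (C * ((k : ℝ) ^ ((max 1 I.rank) ^ 2 * k) * ε⁻¹ ^ (max 1 I.rank)) ^ d)) ∧
        (∃ A : DataStreamAlg α k, ∀ I : SMkMInstance α k, I.IsMonotone →
          A.Approximates I (2 + C * ε) ∧
          A.SpaceAtMost I (C * monotoneSpaceBound k (max 1 I.rank) ε)) := by
  refine ⟨176, by norm_num, 9, fun ε hε hε' k hk α _ => ?_⟩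
  let i₀ : Fin k := ⟨0, by omega⟩
  refine ⟨⟨SearchState.alg ε (fun j => ⌈2 ^ (j + 1) / ε⌉₊) i₀, fun I => ?_⟩,
    ⟨SearchState.alg ε (fun _ => 1) i₀, fun I hI => ?_⟩⟩
  · have hρ : 1 ≤ max 1 I.rank := le_max_left _ _
    have hspace := SearchState.spaceAtMost_alg (i₀ := i₀) (I := I)
      -- The algorithm uses `ℓ` without knowing the rank; only `j` below the rank occur in the tree,
      -- so `Λ` enters the analysis alone.
      (ℓ := fun j => ⌈(2 : ℝ) ^ (j + 1) / ε⌉₊) (Λ := ⌈(2 : ℝ) ^ (max 1 I.rank) / ε⌉₊)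
      hε (by linarith) hk (le_max_right 1 I.rank) hρ (fun j hj => Nat.ceil_mono (by
        gcongr
        · norm_num
        · exact hj)) (Nat.ceil_pos.2 (by positivity))
    have hgen := hspace.mono (space_le_generalSpaceBound hk hρ hε hε')
    refine ⟨(SearchState.approximates_alg hε hε' (I.hasHarmless_ceil hε)).mono i₀ (by linarith),
      hgen, hgen.mono ?_⟩
    exact mul_le_mul_of_nonneg_left (generalSpaceBound_le hk hρ hε hε') (by norm_num)
  · have hρ : 1 ≤ max 1 I.rank := le_max_left _ _
    have hspace := SearchState.spaceAtMost_alg (i₀ := i₀) (I := I) (ℓ := fun _ => 1) (Λ := 1)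
      hε (by linarith) hk (le_max_right 1 I.rank) hρ (fun _ _ => le_rfl) le_rfl
    have hmon := hspace.mono (space_le_monotoneSpaceBound hk hρ hε hε')
    refine ⟨(SearchState.approximates_alg hε hε' (I.hasHarmless_of_isMonotone hε hI)).mono i₀
      (by linarith), hmon.mono ?_⟩
    have := monotoneSpaceBound_nonneg hk hρ hε hε'
    linarith
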